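/- Let $d \ge 1$ be an integer and $\delta \in [0,1]$, and let $\mathcal N_\delta(\rho) = (1-\delta)\rho + \delta\,\mathrm{tr}[\rho]\, I/d$ be the depolarizing channel on $d\times d$ complex matrices. For a unit vector $|\psi\rangle\in\mathbb C^d$ write $\psi = |\psi\rangle\langle\psi|$, and let $d\psi$ be the Haar (unitarily invariant) probability measure on the unit sphere of $\mathbb C^d$. For $p \in (0,1)$ let $$F_{\mathrm{Depo}}(2,p) = \max\left\{ \frac{\int \mathrm{tr}[\sigma_\psi \psi]\,d\psi}{\int \mathrm{tr}[\sigma_\psi]\,d\psi} \;:\; \int \mathrm{tr}[\sigma_\psi]\,d\psi = p,\ \mathcal E \text{ completely positive and trace non-increasing}\right\},\qquad \sigma_\psi = \mathcal E\big(\mathcal N_\delta(\psi)^{\otimes 2}\big),$$ where $\mathcal E$ ranges over the linear maps from operators on $\mathbb C^d\otimes\mathbb C^d$ to operators on $\mathbb C^d$. Let $\lambda_0 = 1 - \frac{d-1}{d}\delta$, $\lambda_j = \frac{\delta}{d}$ for $1\le j\le d-1$, $\Lambda = \mathrm{Diag}(\lambda_0,\dots,\lambda_{d-1})$, $p_2 =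 \frac12(1+\mathrm{tr}[\Lambda^2])$ and $f_2 = \frac{1}{2p_2}(\lambda_0+\lambda_0^2)$. Then the maximum defining $F_{\mathrm{Depo}}(2,p)$ is attained for every $p\in(0,1)$, and: 1. $F_{\mathrm{Depo}}(2,p) \le f_2$ for every $p\in(0,1)$; 2. $F_{\mathrm{Depo}}(2,p) = f_2$ for every $p\in(0,1)$ with $p \le p_2$; 3. consequently $f_2 = \max_{p\in(0,1)} F_{\mathrm{Depo}}(2,p)$; 4. $F_{\mathrm{Depo}}(2,p)$ is non-increasing in $p\in(0,1)$. -/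

import Mathlib

open MeasureTheory Set
open scoped ComplexOrder

noncomputable section

namespace Purification

/-- `E` is completely positive: every ampliation `id_k ⊗ E` maps positive semidefinite matrices to
positive semidefinite matrices. A matrix on `ℂ^k ⊗ ℂ^m` is indexed by `Fin k × m`, and its
`(i, j)` block is `fun a b => M (i, a) (j, b)`. -/
def IsCompletelyPositive {m n : Type*} [Fintype m] [Fintype n]
    (E : Matrix m m ℂ →ₗ[ℂ] Matrix n n ℂ) : Prop :=
  ∀ (k : ℕ) (M : Matrix (Fin k × m) (Fin k × m) ℂ), M.PosSemidef →
    (Matrix.of fun x y : Fin k × n =>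
      E (Matrix.of fun a b => M (x.1, a) (y.1, b)) x.2 y.2).PosSemidef

/-- `E` is completely positive and trace non-increasing (CPTN). -/
def IsCPTN {m n : Type*} [Fintype m] [Fintype n]
    (E : Matrix m m ℂ →ₗ[ℂ] Matrix n n ℂ) : Prop :=
  IsCompletelyPositive E ∧
    ∀ ρ : Matrix m m ℂ, ρ.PosSemidef → (E ρ).trace.re ≤ ρ.trace.re

/-- The uniform (Haar) probability measure on the unit sphere of `ℂ^d`: the normalized surface
measure. -/
def haarSphere (d : ℕ) : Measure (Metric.sphere (0 : EuclideanSpace ℂ (Fin d)) 1) :=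
  ((volume : Measure (EuclideanSpace ℂ (Fin d))).toSphere univ)⁻¹ •
    (volume : Measure (EuclideanSpace ℂ (Fin d))).toSphere

/-- The rank-one matrix `|ψ⟩⟨ψ|`. -/
def pureState {d : ℕ} (ψ : EuclideanSpace ℂ (Fin d)) : Matrix (Fin d) (Fin d) ℂ :=
  Matrix.of fun i j => ψ i * star (ψ j)

/-- The `n`-fold tensor power `ρ^{⊗ n}`, a matrix on `(ℂ^d)^{⊗ n}`, whose computational basis is
indexed by `Fin n → Fin d`. -/
def tensorPower {d : ℕ} (n : ℕ) (ρ : Matrix (Fin d) (Fin d) ℂ) :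
    Matrix (Fin n → Fin d) (Fin n → Fin d) ℂ :=
  Matrix.of fun a b => ∏ i, ρ (a i) (b i)

/-- The unnormalized output `σ_ψ = E(N(ψ)^{⊗ n})`. -/
def outputState {d n : ℕ}
    (N : Matrix (Fin d) (Fin d) ℂ →ₗ[ℂ] Matrix (Fin d) (Fin d) ℂ)
    (E : Matrix (Fin n → Fin d) (Fin n → Fin d) ℂ →ₗ[ℂ] Matrix (Fin d) (Fin d) ℂ)
    (ψ : EuclideanSpace ℂ (Fin d)) : Matrix (Fin d) (Fin d) ℂ :=
  E (tensorPower n (N (pureState ψ)))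

/-- The average success probability `∫ tr[σ_ψ] dψ`; the trace is real for a channel `N` and a
completely positive `E`. -/
def successProbability {d n : ℕ}
    (N : Matrix (Fin d) (Fin d) ℂ →ₗ[ℂ] Matrix (Fin d) (Fin d) ℂ)
    (E : Matrix (Fin n → Fin d) (Fin n → Fin d) ℂ →ₗ[ℂ] Matrix (Fin d) (Fin d) ℂ) : ℝ :=
  ∫ ψ, (outputState N E ψ.1).trace.re ∂haarSphere d

/-- The average overlap `∫ tr[σ_ψ ψ] dψ`; the trace is real for a channel `N` and a completely
positive `E`. -/
def averageOverlap {d n : ℕ}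
    (N : Matrix (Fin d) (Fin d) ℂ →ₗ[ℂ] Matrix (Fin d) (Fin d) ℂ)
    (E : Matrix (Fin n → Fin d) (Fin n → Fin d) ℂ →ₗ[ℂ] Matrix (Fin d) (Fin d) ℂ) : ℝ :=
  ∫ ψ, (outputState N E ψ.1 * pureState ψ.1).trace.re ∂haarSphere d

/-- The fidelities that CPTN protocols with average success probability `p` reach from `n` copies
of the noisy state. -/
def fidelitySet {d : ℕ} (N : Matrix (Fin d) (Fin d) ℂ →ₗ[ℂ] Matrix (Fin d) (Fin d) ℂ)
    (n : ℕ) (p : ℝ) : Set ℝ :=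
  {f | ∃ E : Matrix (Fin n → Fin d) (Fin n → Fin d) ℂ →ₗ[ℂ] Matrix (Fin d) (Fin d) ℂ,
    IsCPTN E ∧ successProbability N E = p ∧ f = averageOverlap N E / successProbability N E}

/-- The maximal universal fidelity `F_N(n, p)`. -/
def maxFidelity {d : ℕ} (N : Matrix (Fin d) (Fin d) ℂ →ₗ[ℂ] Matrix (Fin d) (Fin d) ℂ)
    (n : ℕ) (p : ℝ) : ℝ :=
  sSup (fidelitySet N n p)

/-- The depolarizing channel `ρ ↦ (1 - δ) ρ + δ tr[ρ] I / d`. -/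
def depolarizing (d : ℕ) (δ : ℝ) :
    Matrix (Fin d) (Fin d) ℂ →ₗ[ℂ] Matrix (Fin d) (Fin d) ℂ :=
  ((1 - δ : ℝ) : ℂ) • LinearMap.id +
    ((δ / d : ℝ) : ℂ) • (Matrix.traceLinearMap (Fin d) ℂ ℂ).smulRight 1

/-- The eigenvalue `λ_0 = 1 - (d - 1) δ / d` of a depolarized pure state. -/
def lam0 (d : ℕ) (δ : ℝ) : ℝ := 1 - ((d : ℝ) - 1) / d * δ

/-- The eigenvalue matrix `Λ = Diag(λ_0, …, λ_{d-1})`, with `λ_j = δ / d` for `j ≥ 1`. -/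
def eigenvalueMatrix (d : ℕ) (δ : ℝ) : Matrix (Fin d) (Fin d) ℝ :=
  Matrix.diagonal fun j => if j.val = 0 then lam0 d δ else δ / d

/-- `p_2 = (1 + tr[Λ²]) / 2`. -/
def p2 (d : ℕ) (δ : ℝ) : ℝ := 1 / 2 * (1 + (eigenvalueMatrix d δ ^ 2).trace)

/-- `f_2 = (λ_0 + λ_0²) / (2 p_2)`. -/
def f2 (d : ℕ) (δ : ℝ) : ℝ := 1 / (2 * p2 d δ) * (lam0 d δ + lam0 d δ ^ 2)

end Purification

end

noncomputable section

namespace Purification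

open scoped Real ComplexConjugate Matrix

/-! Upper bound. Overlap and success probability are linear in `E`, and a completely positive map is
a sum of maps `X ↦ K X K†`, so a single `K` suffices (`averageOverlap_le`). For such a map the
integrands are polynomials in `ψ` and its conjugate. The moments of the sphere are sums over
permutations, so the averages depend on `K` only through four numbers: the squared norms `x`, `y` of
its parts symmetric and antisymmetric in the two inputs (`swapNorm`), and the squared norms `P`, `Q`
of their contractions of the output with an input (`contractionNorm`); see `integral_trace_kraus`
and `integral_overlap_kraus`. The contractions enter the overlap with nonnegative coefficients, and
`contractionNorm_le` gives `P ≤ (d + 1) x`, `Q ≤ (d - 1) y`. After this substitution both averages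
are linear in `x` and `y`. The ratio of the `x` coefficients is exactly `f2`, and the `y`
coefficient of the overlap is at most `f2` times that of the success probability
(`overlap_le_of_swap_bounds`).

Attainment of the bound. Projecting the two copies onto the symmetric subspace and discarding one
yields `(ρ + ρ²) / 2`, with success probability `p2` and fidelity `f2`. Multiplying a protocol by a
constant in `[0, 1]` lowers its success probability and keeps its fidelity. This gives equality for
all `p ≤ p2`, and also monotonicity in `p`.

Existence of the maximum. The CPTN maps form a compact set on which both averages are continuous,
and for `p` in `(0, 1)` the constraint is feasible because a trace-preserving protocol can be scaled
by `p`. -/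

/-! ### Moments of the sphere from Gaussian integrals. -/

theorem integral_gaussian_monomial (a b : ℕ) :
    ∫ z : ℂ, z ^ a * conj z ^ b * (Real.exp (-‖z‖ ^ 2) : ℂ) =
      if a = b then (π * a.factorial : ℂ) else 0 := by
  split_ifs with h
  · subst h
    have key := Complex.integral_rpow_mul_exp_neg_rpow (p := 2) (q := 2 * a) (by norm_num)
      (by have : (0 : ℝ) ≤ a := a.cast_nonneg
          linarith)
    have hΓ : Real.Gamma ((2 * (a : ℝ) + 2) / 2) = (a.factorial : ℝ) := by
      rw [← Real.Gamma_nat_eq_factorial]; congr 1; ring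
    rw [hΓ] at key
    have : ∀ z : ℂ, z ^ a * conj z ^ a * (Real.exp (-‖z‖ ^ 2) : ℂ) =
        ((‖z‖ ^ (2 * (a : ℝ)) * Real.exp (-‖z‖ ^ (2 : ℝ)) : ℝ) : ℂ) := by
      intro z
      rw [← mul_pow, Complex.mul_conj, Complex.normSq_eq_norm_sq,
        Real.rpow_mul (norm_nonneg z), Real.rpow_natCast, Real.rpow_two]
      push_cast
      rfl
    simp_rw [this]
    rw [integral_complex_ofReal, key]
    push_cast
    ring
  · obtain ⟨ω, hω⟩ : ∃ ω : Circle, (ω : ℂ) ^ a * conj (ω : ℂ) ^ b ≠ 1 := by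
      -- Rotating by this angle multiplies the monomial by `exp (iπ) = -1`, so its invariant
      -- integral must vanish.
      refine ⟨Circle.exp (π / ((a : ℝ) - b)), ?_⟩
      have hab : (a : ℂ) - b ≠ 0 := by
        rw [sub_ne_zero]; exact_mod_cast h
      rw [← Circle.coe_inv_eq_conj, ← Circle.exp_neg, Circle.coe_exp, Circle.coe_exp,
        ← Complex.exp_nat_mul, ← Complex.exp_nat_mul, ← Complex.exp_add]
      have : (a : ℂ) * (((π / ((a : ℝ) - b) : ℝ) : ℂ) * Complex.I) +
          b * (((-(π / ((a : ℝ) - b)) : ℝ) : ℂ) * Complex.I) = π * Complex.I := by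
        push_cast
        field_simp
        ring
      rw [this, Complex.exp_pi_mul_I]
      norm_num
    have hinv := (rotation ω).measurePreserving.integral_comp
      (rotation ω).toHomeomorph.measurableEmbedding
      (fun z : ℂ => z ^ a * conj z ^ b * (Real.exp (-‖z‖ ^ 2) : ℂ))
    have hrot : ∀ z : ℂ, rotation ω z ^ a * conj (rotation ω z) ^ b *
        (Real.exp (-‖rotation ω z‖ ^ 2) : ℂ) =
        ((ω : ℂ) ^ a * conj (ω : ℂ) ^ b) * (z ^ a * conj z ^ b * (Real.exp (-‖z‖ ^ 2) : ℂ)) := by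
      intro z
      rw [LinearIsometryEquiv.norm_map, rotation_apply, map_mul, mul_pow, mul_pow]
      ring
    simp_rw [hrot] at hinv
    rw [integral_const_mul] at hinv
    by_contra h0
    exact hω (mul_right_cancel₀ h0 (by rw [hinv, one_mul]))

/-- The number of permutations of the indices that carry the word `b` to the word `a`. -/
def matchings {n : ℕ} {ι : Type*} [DecidableEq ι] (a b : Fin n → ι) : ℕ :=
  (Finset.univ.filter fun σ : Equiv.Perm (Fin n) => a = b ∘ σ).card

/-- If the letter counts agree, the matchings form a coset of the stabilizer of `b`. The product
form is what the factorized Gaussian integral produces. -/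
theorem matchings_eq_prod {n : ℕ} {ι : Type*} [DecidableEq ι] [Fintype ι] (a b : Fin n → ι) :
    matchings a b = ∏ i, if Fintype.card {l // a l = i} = Fintype.card {l // b l = i}
      then (Fintype.card {l // a l = i}).factorial else 0 := by
  by_cases h : ∀ i, Fintype.card {l // a l = i} = Fintype.card {l // b l = i}
  · simp_rw [h, if_true]
    rw [← DomMulAct.stabilizer_card b]
    let e : Fin n ≃ Fin n := (Equiv.sigmaFiberEquiv a).symm.trans
      ((Equiv.sigmaCongrRight fun i => Fintype.equivOfCardEq (h i)).trans
        (Equiv.sigmaFiberEquiv b))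
    have he : a = b ∘ e := by
      funext l
      exact ((Fintype.equivOfCardEq (h (a l))) ⟨l, rfl⟩).2.symm
    rw [matchings, ← Fintype.card_subtype]
    refine Fintype.card_congr
      ((Equiv.subtypeEquiv (Equiv.mulRight e⁻¹) fun σ => ?_))
    constructor
    · intro hσ
      funext l
      have := congrFun (hσ.symm.trans he) (e⁻¹ l)
      simpa using this
    · intro hσ
      rw [he]
      funext l
      have := congrFun hσ (e l)
      simpa using this.symm
  · rw [not_forall] at h
    obtain ⟨i, hi⟩ := h
    rw [Finset.prod_eq_zero (Finset.mem_univ i) (if_neg hi), matchings, Finset.card_eq_zero,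
      Finset.filter_eq_empty_iff]
    rintro σ - rfl
    exact hi (Fintype.card_congr (Equiv.subtypeEquiv σ fun l => Iff.rfl))

theorem integral_pi_gaussian_monomial {n d : ℕ} (a b : Fin n → Fin d) :
    ∫ x : Fin d → ℂ, (∏ l, x (a l)) * (∏ l, conj (x (b l))) *
        (Real.exp (-∑ i, ‖x i‖ ^ 2) : ℂ) = π ^ d * matchings a b := by
  have hmono : ∀ (c : Fin n → Fin d) (y : Fin d → ℂ),
      ∏ l, y (c l) = ∏ i, y i ^ Fintype.card {l // c l = i} := by
    intro c y
    rw [← Finset.prod_fiberwise Finset.univ c]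
    refine Finset.prod_congr rfl fun i _ => ?_
    rw [Fintype.card_subtype, ← Finset.prod_const]
    refine Finset.prod_congr rfl fun l hl => ?_
    rw [(Finset.mem_filter.mp hl).2]
  have : ∀ x : Fin d → ℂ, (∏ l, x (a l)) * (∏ l, conj (x (b l))) *
        (Real.exp (-∑ i, ‖x i‖ ^ 2) : ℂ) =
      ∏ i, (x i ^ Fintype.card {l // a l = i} * conj (x i) ^ Fintype.card {l // b l = i} *
        (Real.exp (-‖x i‖ ^ 2) : ℂ)) := by
    intro x
    rw [hmono a x, hmono b fun i => conj (x i), ← Finset.sum_neg_distrib, Real.exp_sum,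
      Complex.ofReal_prod, ← Finset.prod_mul_distrib, ← Finset.prod_mul_distrib]
  simp_rw [this]
  rw [integral_fintype_prod_volume_eq_prod (fun (i : Fin d) (z : ℂ) =>
    z ^ Fintype.card {l // a l = i} * conj z ^ Fintype.card {l // b l = i} *
        (Real.exp (-‖z‖ ^ 2) : ℂ))]
  simp_rw [integral_gaussian_monomial, matchings_eq_prod]
  push_cast
  have hpi : (π : ℂ) ^ d = ∏ _i : Fin d, (π : ℂ) := by simp
  rw [hpi, ← Finset.prod_mul_distrib]
  refine Finset.prod_congr rfl fun i _ => ?_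
  split_ifs <;> simp

/-- Polar coordinates: homogeneity separates the radial variable, so the Gaussian integral is the
sphere integral times a factor depending only on the degree. -/
theorem integral_mul_exp_eq_integral_toSphere {F : Type*} [NormedAddCommGroup F] [NormedSpace ℝ F]
    [MeasurableSpace F] [BorelSpace F] [FiniteDimensional ℝ F] [Nontrivial F] (μ : Measure F)
    [μ.IsAddHaarMeasure] (k : ℕ) (f : F → ℂ) (hf : ∀ (r : ℝ) (x : F), f (r • x) = r ^ k * f x) :
    ∫ x, f x * (Real.exp (-‖x‖ ^ 2) : ℂ) ∂μ =
      (∫ x, f x.1 ∂μ.toSphere) * ∫ r : Ioi (0 : ℝ), (r.1 ^ k * Real.exp (-r.1 ^ 2) : ℂ)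
        ∂Measure.volumeIoiPow (Module.finrank ℝ F - 1) := by
  calc
    _ = ∫ x : ({(0)}ᶜ : Set F), f x * (Real.exp (-‖x.1‖ ^ 2) : ℂ) ∂(μ.comap (↑)) := by
      rw [integral_subtype_comap (measurableSet_singleton _).compl
        fun x ↦ f x * (Real.exp (-‖x‖ ^ 2) : ℂ), restrict_compl_singleton]
    _ = ∫ x, f x.1.1 * (x.2.1 ^ k * Real.exp (-x.2.1 ^ 2) : ℂ)
        ∂μ.toSphere.prod (.volumeIoiPow (Module.finrank ℝ F - 1)) := by
      rw [← μ.measurePreserving_homeomorphUnitSphereProd.integral_comp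
        (Homeomorph.measurableEmbedding _)]
      refine integral_congr_ae (Filter.Eventually.of_forall fun x => ?_)
      have hx : ‖x.1‖ ≠ 0 := norm_ne_zero_iff.mpr x.2
      simp only [homeomorphUnitSphereProd_apply_fst_coe, homeomorphUnitSphereProd_apply_snd_coe]
      rw [hf]
      push_cast
      have : ((‖x.1‖ : ℂ)) ≠ 0 := by exact_mod_cast hx
      rw [inv_pow]
      field_simp
    _ = _ := by
      rw [← integral_prod_mul]

/-- Uniqueness of Haar measure. The value of `c` is irrelevant, since the moments are normalized
afterwards. -/
theorem integral_euclideanSpace_eq (d : ℕ) : ∃ c : ℝ, c ≠ 0 ∧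
    ∀ f : EuclideanSpace ℂ (Fin d) → ℂ,
      ∫ x, f x = c * ∫ x : Fin d → ℂ, f (WithLp.toLp 2 x) := by
  let e : (Fin d → ℂ) ≃L[ℝ] EuclideanSpace ℂ (Fin d) :=
    (PiLp.continuousLinearEquiv 2 ℝ fun _ : Fin d => ℂ).symm
  let μ : Measure (EuclideanSpace ℂ (Fin d)) := (volume : Measure (Fin d → ℂ)).map e
  have : μ.IsAddHaarMeasure := e.isAddHaarMeasure_map volume
  refine ⟨(volume : Measure (EuclideanSpace ℂ (Fin d))).addHaarScalarFactor μ, ?_, fun f => ?_⟩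
  · exact_mod_cast (Measure.addHaarScalarFactor_pos_of_isAddHaarMeasure _ μ).ne'
  · have hmap : ∫ x, f x ∂μ = ∫ x : Fin d → ℂ, f (WithLp.toLp 2 x) :=
      e.toHomeomorph.measurableEmbedding.integral_map f
    conv_lhs => rw [Measure.isAddLeftInvariant_eq_smul
      (volume : Measure (EuclideanSpace ℂ (Fin d))) μ]
    rw [integral_smul_nnreal_measure, hmap, NNReal.smul_def, Complex.real_smul]

theorem isProbabilityMeasure_haarSphere {d : ℕ} (hd : 1 ≤ d) :
    IsProbabilityMeasure (haarSphere d) := by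
  have : NeZero d := ⟨by omega⟩
  have : Nonempty (Fin d) := ⟨0⟩
  constructor
  rw [haarSphere, Measure.smul_apply, smul_eq_mul]
  refine ENNReal.inv_mul_cancel ?_ (measure_ne_top _ _)
  rw [ne_eq, Measure.measure_univ_eq_zero]
  exact Measure.toSphere_ne_zero _

theorem exists_integral_haarSphere_monomial {d : ℕ} (hd : 1 ≤ d) (n : ℕ) :
    ∃ c : ℂ, ∀ a b : Fin n → Fin d,
      ∫ ψ, (∏ l, ψ.1 (a l)) * (∏ l, conj (ψ.1 (b l))) ∂haarSphere d = c * matchings a b := by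
  have : NeZero d := ⟨by omega⟩
  have : Nonempty (Fin d) := ⟨0⟩
  obtain ⟨c, hc, hcint⟩ := integral_euclideanSpace_eq d
  set C : ℂ := ∫ r : Ioi (0 : ℝ), (r.1 ^ (2 * n) * Real.exp (-r.1 ^ 2) : ℂ)
        ∂Measure.volumeIoiPow (Module.finrank ℝ (EuclideanSpace ℂ (Fin d)) - 1)
  have key : ∀ a b : Fin n → Fin d,
      (∫ ψ, (∏ l, ψ.1 (a l)) * (∏ l, conj (ψ.1 (b l)))
        ∂(volume : Measure (EuclideanSpace ℂ (Fin d))).toSphere) * C =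
      c * (π ^ d * matchings a b) := by
    intro a b
    rw [← integral_pi_gaussian_monomial, ← integral_mul_exp_eq_integral_toSphere _ (2 * n)
      (fun x : EuclideanSpace ℂ (Fin d) => (∏ l, x (a l)) * (∏ l, conj (x (b l)))), hcint]
    · simp_rw [EuclideanSpace.norm_sq_eq]
    · intro r x
      simp [Finset.prod_mul_distrib]
      ring
  -- A vanishing radial factor would kill the moment of a constant word, whose Gaussian counterpart
  -- is nonzero.
  have hC : C ≠ 0 := by
    intro hC
    have h := key (fun _ => 0) (fun _ => 0)
    have hpos : matchings (fun _ : Fin n => (0 : Fin d)) (fun _ => 0) ≠ 0 := by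
      rw [matchings, Finset.card_ne_zero]
      exact ⟨1, by simp⟩
    rw [hC, mul_zero] at h
    have : (c : ℂ) * (π ^ d * matchings (fun _ : Fin n => (0 : Fin d)) (fun _ => 0)) ≠ 0 := by
      refine mul_ne_zero (by exact_mod_cast hc) (mul_ne_zero (pow_ne_zero _ ?_) ?_)
      · exact_mod_cast Real.pi_ne_zero
      · exact_mod_cast hpos
    exact this h.symm
  refine ⟨((volume : Measure (EuclideanSpace ℂ (Fin d))).toSphere univ)⁻¹.toReal *
    (c * π ^ d / C), fun a b => ?_⟩
  rw [haarSphere, integral_smul_measure, Complex.real_smul, eq_div_of_mul_eq hC (key a b)]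
  ring

theorem matchings_cast {n : ℕ} {ι : Type*} [DecidableEq ι] (a b : Fin n → ι) :
    (matchings a b : ℂ) =
      ∑ σ : Equiv.Perm (Fin n), ∏ l, if a l = b (σ l) then (1 : ℂ) else 0 := by
  rw [matchings, Finset.card_filter]
  push_cast
  refine Finset.sum_congr rfl fun σ _ => ?_
  rw [Finset.prod_ite_zero]
  simp [funext_iff]

theorem matchings_one {ι : Type*} [DecidableEq ι] (i k : ι) :
    (matchings ![i] ![k] : ℂ) = if i = k then 1 else 0 := by
  rw [matchings_cast]
  simp

theorem matchings_two {ι : Type*} [DecidableEq ι] (i j k l : ι) :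
    (matchings ![i, j] ![k, l] : ℂ) =
      (if i = k then 1 else 0) * (if j = l then 1 else 0) +
      (if i = l then 1 else 0) * (if j = k then 1 else 0) := by
  have hu : (Finset.univ : Finset (Equiv.Perm (Fin 2))) = {1, Equiv.swap 0 1} := by decide
  rw [matchings_cast, hu, Finset.sum_pair (by decide), Fin.prod_univ_two, Fin.prod_univ_two]
  rfl

theorem matchings_three {ι : Type*} [DecidableEq ι] (i j m k l n : ι) :
    (matchings ![i, j, m] ![k, l, n] : ℂ) =
      (if i = k then 1 else 0) * (if j = l then 1 else 0) * (if m = n then 1 else 0) +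
      (if i = k then 1 else 0) * (if j = n then 1 else 0) * (if m = l then 1 else 0) +
      (if i = l then 1 else 0) * (if j = k then 1 else 0) * (if m = n then 1 else 0) +
      (if i = l then 1 else 0) * (if j = n then 1 else 0) * (if m = k then 1 else 0) +
      (if i = n then 1 else 0) * (if j = k then 1 else 0) * (if m = l then 1 else 0) +
      (if i = n then 1 else 0) * (if j = l then 1 else 0) * (if m = k then 1 else 0) := by
  have hu : (Finset.univ : Finset (Equiv.Perm (Fin 3))) =
      {1, Equiv.swap 1 2, Equiv.swap 0 1, Equiv.swap 0 1 * Equiv.swap 1 2,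
        Equiv.swap 1 2 * Equiv.swap 0 1, Equiv.swap 0 2} := by decide
  rw [matchings_cast, hu]
  repeat rw [Finset.sum_insert (by decide)]
  rw [Finset.sum_singleton]
  simp only [Fin.prod_univ_three, ← add_assoc]
  rfl

theorem integrable_haarSphere {d : ℕ} (hd : 1 ≤ d) {F : Type*} [NormedAddCommGroup F]
    {f : Metric.sphere (0 : EuclideanSpace ℂ (Fin d)) 1 → F} (hf : Continuous f) :
    Integrable f (haarSphere d) := by
  have := isProbabilityMeasure_haarSphere hd
  exact hf.integrable_of_hasCompactSupport (HasCompactSupport.of_compactSpace f)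

theorem sum_mul_conj_eq_one {d : ℕ} (ψ : Metric.sphere (0 : EuclideanSpace ℂ (Fin d)) 1) :
    ∑ i, ψ.1 i * conj (ψ.1 i) = 1 := by
  have h : ‖ψ.1‖ ^ 2 = 1 := by rw [norm_eq_of_mem_sphere, one_pow]
  rw [EuclideanSpace.norm_sq_eq] at h
  simp_rw [Complex.mul_conj, Complex.normSq_eq_norm_sq]
  exact_mod_cast h

/-- Expansion of `(∑ |ψ i|²)^n = 1`. It fixes the unknown constant in
`exists_integral_haarSphere_monomial`. -/
theorem sum_integral_monomial {d : ℕ} (hd : 1 ≤ d) (n : ℕ) :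
    ∑ a : Fin n → Fin d,
      ∫ ψ, (∏ l, ψ.1 (a l)) * (∏ l, conj (ψ.1 (a l))) ∂haarSphere d = 1 := by
  have := isProbabilityMeasure_haarSphere hd
  rw [← integral_finsetSum _ fun a _ => integrable_haarSphere hd (by fun_prop)]
  have : ∀ ψ : Metric.sphere (0 : EuclideanSpace ℂ (Fin d)) 1,
      ∑ a : Fin n → Fin d, (∏ l, ψ.1 (a l)) * (∏ l, conj (ψ.1 (a l))) = 1 := by
    intro ψ
    simp_rw [← Finset.prod_mul_distrib]
    have h := Finset.prod_univ_sum (fun _ => Finset.univ)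
      fun (_ : Fin n) (i : Fin d) => ψ.1 i * conj (ψ.1 i)
    rw [Fintype.piFinset_univ] at h
    rw [← h]
    simp [sum_mul_conj_eq_one]
  simp_rw [this]
  simp

theorem integral_monomial_one {d : ℕ} (hd : 1 ≤ d) (i k : Fin d) :
    ∫ ψ, ψ.1 i * conj (ψ.1 k) ∂haarSphere d = (if i = k then 1 else 0) / d := by
  obtain ⟨c, hc⟩ := exists_integral_haarSphere_monomial hd 1
  have hn := sum_integral_monomial hd 1
  simp_rw [hc] at hn
  rw [← Equiv.sum_comp (Equiv.funUnique (Fin 1) (Fin d)).symm] at hn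
  have : ∀ x : Fin d, (Equiv.funUnique (Fin 1) (Fin d)).symm x = ![x] := by
    intro x; funext l; fin_cases l; rfl
  simp_rw [this, matchings_one] at hn
  have hd0 : (d : ℂ) ≠ 0 := by exact_mod_cast (by omega : d ≠ 0)
  have h := hc ![i] ![k]
  rw [matchings_one] at h
  simp only [Fin.prod_univ_one, Matrix.cons_val] at h
  have hn' : c * d = 1 := by
    refine Eq.trans ?_ hn
    simp
    ring
  rw [h, eq_div_of_mul_eq hd0 hn']
  ring

theorem integral_monomial_two {d : ℕ} (hd : 1 ≤ d) (i j k l : Fin d) :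
    ∫ ψ, ψ.1 i * ψ.1 j * (conj (ψ.1 k) * conj (ψ.1 l)) ∂haarSphere d =
      ((if i = k then 1 else 0) * (if j = l then 1 else 0) +
      (if i = l then 1 else 0) * (if j = k then 1 else 0)) / (d * (d + 1)) := by
  obtain ⟨c, hc⟩ := exists_integral_haarSphere_monomial hd 2
  have hn := sum_integral_monomial hd 2
  simp_rw [hc] at hn
  rw [← Equiv.sum_comp (finTwoArrowEquiv (Fin d)).symm, Fintype.sum_prod_type] at hn
  simp_rw [finTwoArrowEquiv_symm_apply, matchings_two] at hn
  have hd0 : (d : ℂ) * (d + 1) ≠ 0 := by exact_mod_cast (by positivity)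
  have h := hc ![i, j] ![k, l]
  rw [matchings_two] at h
  simp only [Fin.prod_univ_two, Matrix.cons_val] at h
  have hn' : c * (d * (d + 1)) = 1 := by
    refine Eq.trans ?_ hn
    simp [← Finset.mul_sum, Finset.sum_add_distrib]
    ring
  rw [h, eq_div_of_mul_eq hd0 hn']
  ring

theorem integral_monomial_three {d : ℕ} (hd : 1 ≤ d) (i j m k l n : Fin d) :
    ∫ ψ, ψ.1 i * ψ.1 j * ψ.1 m * (conj (ψ.1 k) * conj (ψ.1 l) * conj (ψ.1 n)) ∂haarSphere d =
      ((if i = k then 1 else 0) * (if j = l then 1 else 0) * (if m = n then 1 else 0) +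
      (if i = k then 1 else 0) * (if j = n then 1 else 0) * (if m = l then 1 else 0) +
      (if i = l then 1 else 0) * (if j = k then 1 else 0) * (if m = n then 1 else 0) +
      (if i = l then 1 else 0) * (if j = n then 1 else 0) * (if m = k then 1 else 0) +
      (if i = n then 1 else 0) * (if j = k then 1 else 0) * (if m = l then 1 else 0) +
      (if i = n then 1 else 0) * (if j = l then 1 else 0) * (if m = k then 1 else 0)) /
      (d * (d + 1) * (d + 2)) := by
  obtain ⟨c, hc⟩ := exists_integral_haarSphere_monomial hd 3
  have hn := sum_integral_monomial hd 3
  simp_rw [hc] at hn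
  rw [← Equiv.sum_comp (Fin.consEquiv fun _ : Fin 3 => Fin d), Fintype.sum_prod_type] at hn
  simp_rw [← Equiv.sum_comp (finTwoArrowEquiv (Fin d)).symm, Fintype.sum_prod_type] at hn
  have hcons : ∀ x y z : Fin d, (Fin.consEquiv fun _ : Fin 3 => Fin d)
      (x, (finTwoArrowEquiv (Fin d)).symm (y, z)) = ![x, y, z] := fun x y z => rfl
  simp_rw [hcons, matchings_three] at hn
  have hd0 : (d : ℂ) * (d + 1) * (d + 2) ≠ 0 := by exact_mod_cast (by positivity)
  have h := hc ![i, j, m] ![k, l, n]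
  rw [matchings_three] at h
  simp only [Fin.prod_univ_three, Matrix.cons_val] at h
  have hn' : c * (d * (d + 1) * (d + 2)) = 1 := by
    refine Eq.trans ?_ hn
    simp [← Finset.mul_sum, Finset.sum_add_distrib]
    ring
  rw [h, eq_div_of_mul_eq hd0 hn']
  ring

/-! ### Averages of squared moduli of polynomials on the sphere. -/

theorem integral_haarSphere_sum {d : ℕ} (hd : 1 ≤ d) {ι : Type*} [Fintype ι]
    (f : ι → Metric.sphere (0 : EuclideanSpace ℂ (Fin d)) 1 → ℂ) (hf : ∀ i, Continuous (f i)) :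
    ∫ ψ, ∑ i, f i ψ ∂haarSphere d = ∑ i, ∫ ψ, f i ψ ∂haarSphere d :=
  integral_finsetSum _ fun i _ => integrable_haarSphere hd (hf i)

theorem integral_normSq_linear {d : ℕ} (hd : 1 ≤ d) (v : Fin d → ℂ) :
    ∫ ψ, (∑ a, v a * ψ.1 a) * conj (∑ a, v a * ψ.1 a) ∂haarSphere d =
      (∑ a, v a * conj (v a)) / d := by
  have hpt : ∀ ψ : Metric.sphere (0 : EuclideanSpace ℂ (Fin d)) 1,
      (∑ a, v a * ψ.1 a) * conj (∑ a, v a * ψ.1 a) =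
      ∑ a, ∑ b, v a * conj (v b) * (ψ.1 a * conj (ψ.1 b)) := by
    intro ψ
    simp only [map_sum, map_mul, Finset.sum_mul_sum]
    refine Finset.sum_congr rfl fun a _ => Finset.sum_congr rfl fun b _ => ?_
    ring
  simp_rw [hpt]
  simp (disch := intros; fun_prop) only [integral_haarSphere_sum hd, integral_const_mul,
    integral_monomial_one hd]
  simp [div_eq_mul_inv, Finset.sum_mul]

theorem integral_normSq_quadratic {d : ℕ} (hd : 1 ≤ d) (M : Fin d → Fin d → ℂ) :
    ∫ ψ, (∑ a, ∑ b, M a b * (ψ.1 a * ψ.1 b)) * conj (∑ a, ∑ b, M a b * (ψ.1 a * ψ.1 b))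
        ∂haarSphere d =
      ((∑ a, ∑ b, M a b * conj (M a b)) + ∑ a, ∑ b, M a b * conj (M b a)) / (d * (d + 1)) := by
  have hpt : ∀ ψ : Metric.sphere (0 : EuclideanSpace ℂ (Fin d)) 1,
      (∑ a, ∑ b, M a b * (ψ.1 a * ψ.1 b)) * conj (∑ a, ∑ b, M a b * (ψ.1 a * ψ.1 b)) =
      ∑ a, ∑ b, ∑ i, ∑ j, M a b * conj (M i j) *
        (ψ.1 a * ψ.1 b * (conj (ψ.1 i) * conj (ψ.1 j))) := by
    intro ψ
    simp only [map_sum, map_mul, Finset.sum_mul]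
    simp only [Finset.mul_sum]
    refine Finset.sum_congr rfl fun a _ => Finset.sum_congr rfl fun b _ =>
      Finset.sum_congr rfl fun i _ => Finset.sum_congr rfl fun j _ => ?_
    ring
  simp_rw [hpt]
  simp (disch := intros; fun_prop) only [integral_haarSphere_sum hd, integral_const_mul,
    integral_monomial_two hd]
  simp [div_eq_mul_inv, mul_add, add_mul, Finset.sum_add_distrib, Finset.sum_mul]

theorem integral_normSq_sesquilinear {d : ℕ} (hd : 1 ≤ d) (M : Fin d → Fin d → ℂ) :
    ∫ ψ, (∑ i, ∑ a, M i a * (conj (ψ.1 i) * ψ.1 a)) *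
        conj (∑ i, ∑ a, M i a * (conj (ψ.1 i) * ψ.1 a)) ∂haarSphere d =
      ((∑ i, ∑ a, M i a * conj (M i a)) + (∑ i, M i i) * conj (∑ i, M i i)) /
        (d * (d + 1)) := by
  have hpt : ∀ ψ : Metric.sphere (0 : EuclideanSpace ℂ (Fin d)) 1,
      (∑ i, ∑ a, M i a * (conj (ψ.1 i) * ψ.1 a)) *
        conj (∑ i, ∑ a, M i a * (conj (ψ.1 i) * ψ.1 a)) =
      ∑ i, ∑ a, ∑ j, ∑ b, M i a * conj (M j b) *
        (ψ.1 a * ψ.1 j * (conj (ψ.1 b) * conj (ψ.1 i))) := by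
    intro ψ
    simp only [map_sum, map_mul, Finset.sum_mul]
    simp only [Finset.mul_sum, Complex.conj_conj]
    refine Finset.sum_congr rfl fun a _ => Finset.sum_congr rfl fun b _ =>
      Finset.sum_congr rfl fun i _ => Finset.sum_congr rfl fun j _ => ?_
    ring
  simp_rw [hpt]
  simp (disch := intros; fun_prop) only [integral_haarSphere_sum hd, integral_const_mul,
    integral_monomial_two hd]
  simp [div_eq_mul_inv, mul_add, add_mul, Finset.sum_add_distrib, Finset.sum_mul,
    Finset.mul_sum]
  exact Finset.sum_comm

/-- Of the six matchings, two pair the output index of `K` with that of its conjugate and give the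
first two sums. The other four contract an output with an input in each factor and assemble into one
squared norm. -/
theorem integral_normSq_cubic {d : ℕ} (hd : 1 ≤ d) (K : Fin d → Fin d → Fin d → ℂ) :
    ∫ ψ, (∑ i, ∑ a, ∑ b, K i a b * (conj (ψ.1 i) * ψ.1 a * ψ.1 b)) *
        conj (∑ i, ∑ a, ∑ b, K i a b * (conj (ψ.1 i) * ψ.1 a * ψ.1 b)) ∂haarSphere d =
      ((∑ i, ∑ a, ∑ b, K i a b * conj (K i a b)) + (∑ i, ∑ a, ∑ b, K i a b * conj (K i b a)) +
        ∑ c, (∑ i, (K i i c + K i c i)) * conj (∑ i, (K i i c + K i c i))) /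
        (d * (d + 1) * (d + 2)) := by
  have hpt : ∀ ψ : Metric.sphere (0 : EuclideanSpace ℂ (Fin d)) 1,
      (∑ i, ∑ a, ∑ b, K i a b * (conj (ψ.1 i) * ψ.1 a * ψ.1 b)) *
        conj (∑ i, ∑ a, ∑ b, K i a b * (conj (ψ.1 i) * ψ.1 a * ψ.1 b)) =
      ∑ i, ∑ a, ∑ b, ∑ j, ∑ m, ∑ n, K i a b * conj (K j m n) *
        (ψ.1 a * ψ.1 b * ψ.1 j * (conj (ψ.1 m) * conj (ψ.1 n) * conj (ψ.1 i))) := by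
    intro ψ
    simp only [map_sum, map_mul, Finset.sum_mul]
    simp only [Finset.mul_sum, Complex.conj_conj]
    refine Finset.sum_congr rfl fun i _ => Finset.sum_congr rfl fun a _ =>
      Finset.sum_congr rfl fun b _ => Finset.sum_congr rfl fun j _ =>
      Finset.sum_congr rfl fun m _ => Finset.sum_congr rfl fun n _ => ?_
    ring
  simp_rw [hpt]
  simp (disch := intros; fun_prop) only [integral_haarSphere_sum hd, integral_const_mul,
    integral_monomial_three hd]
  beta_reduce
  simp only [div_eq_mul_inv]
  generalize ((d : ℂ) * (d + 1) * (d + 2))⁻¹ = D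
  simp [ mul_add, add_mul, Finset.sum_add_distrib, Finset.sum_mul,
    Finset.mul_sum]
  have rot : ∀ F : Fin d → Fin d → Fin d → ℂ,
      ∑ x, ∑ y, ∑ z, F x y z = ∑ y, ∑ z, ∑ x, F x y z := fun F => by
    rw [Finset.sum_comm]
    exact Finset.sum_congr rfl fun y _ => Finset.sum_comm
  rw [rot fun x y z => K x y x * conj (K z y z) * D, rot fun x y z => K x y x * conj (K z z y) * D,
    rot fun x y z => K x x y * conj (K z y z) * D, rot fun x y z => K x x y * conj (K z z y) * D]
  ring

/-! ### Symmetric and antisymmetric parts of a Kraus operator. -/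

/-- Half the squared norm of `K` plus `η` times `K` with the two input factors exchanged. -/
def swapNorm {d : ℕ} (η : ℝ) (K : Fin d → Fin d → Fin d → ℂ) : ℝ :=
  (∑ i, ∑ a, ∑ b, Complex.normSq (K i a b + η * K i b a)) / 2

/-- The squared norm of the contraction of the output of `K` plus `η` times its swap with the first
input factor. -/
def contractionNorm {d : ℕ} (η : ℝ) (K : Fin d → Fin d → Fin d → ℂ) : ℝ :=
  ∑ c, Complex.normSq (∑ i, (K i i c + η * K i c i))

theorem swapNorm_nonneg {d : ℕ} (η : ℝ) (K : Fin d → Fin d → Fin d → ℂ) : 0 ≤ swapNorm η K := by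
  have : 0 ≤ ∑ i, ∑ a, ∑ b, Complex.normSq (K i a b + η * K i b a) :=
    Finset.sum_nonneg fun i _ => Finset.sum_nonneg fun a _ => Finset.sum_nonneg fun b _ =>
      Complex.normSq_nonneg _
  rw [swapNorm]
  linarith

/-- With `w` the contraction of `L`, the tensor `δ_{ia} w_b + η δ_{ib} w_a` has the same swap
symmetry as `L`, contraction `(d + η) w`, and inner product `2 ‖w‖²` with `L`. The claim is that the
squared norm of `(d + η) L` minus this tensor is nonnegative. -/
theorem contraction_le_of_swap_eq {d : ℕ} {η : ℝ} (hη : η ^ 2 = 1) (hpos : 0 < d + η)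
    (L : Fin d → Fin d → Fin d → ℂ) (hL : ∀ i a b, L i b a = η * L i a b) :
    ∑ c, Complex.normSq (∑ i, L i i c) ≤
      (d + η) * ((∑ i, ∑ a, ∑ b, Complex.normSq (L i a b)) / 2) := by
  set w : Fin d → ℂ := fun c => ∑ i, L i i c with hw
  have hη' : (η : ℂ) * η = 1 := by rw [← pow_two]; exact_mod_cast hη
  have key : ∑ i, ∑ a, ∑ b, Complex.normSq (((d + η : ℝ) : ℂ) * L i a b -
      ((if i = a then w b else 0) + η * (if i = b then w a else 0))) =
      (d + η) ^ 2 * (∑ i, ∑ a, ∑ b, Complex.normSq (L i a b)) -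
        2 * (d + η) * ∑ c, Complex.normSq (w c) := by
    have hw1 : ∑ i, ∑ a, ∑ b, L i a b * conj (if i = a then w b else 0) =
        ∑ c, w c * conj (w c) := by
      simp only [apply_ite conj, map_zero, mul_ite, mul_zero]
      simp only [Finset.sum_ite_irrel, Finset.sum_const_zero, Finset.sum_ite_eq, Finset.mem_univ,
        if_true]
      rw [Finset.sum_comm]
      simp only [hw, Finset.sum_mul]
    have hw2 : ∑ i, ∑ a, ∑ b, L i a b * conj (η * (if i = b then w a else 0)) =
        ∑ c, w c * conj (w c) := by
      rw [← hw1]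
      refine Finset.sum_congr rfl fun i _ => ?_
      rw [Finset.sum_comm]
      refine Finset.sum_congr rfl fun a _ => Finset.sum_congr rfl fun b _ => ?_
      rw [hL i a b, map_mul, Complex.conj_ofReal]
      linear_combination (L i a b * conj (if i = a then w b else 0)) * hη'
    have hwc1 : ∑ i, ∑ a, ∑ b, (if i = a then w b else 0) * conj (L i a b) =
        ∑ c, w c * conj (w c) := by
      have := congrArg conj hw1
      simp only [map_sum, map_mul, Complex.conj_conj] at this
      simpa only [mul_comm] using this
    have hwc2 : ∑ i, ∑ a, ∑ b, (η * (if i = b then w a else 0)) * conj (L i a b) =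
        ∑ c, w c * conj (w c) := by
      have := congrArg conj hw2
      simp only [map_sum, map_mul, Complex.conj_conj] at this
      simpa only [mul_comm] using this
    have hww : ∑ i, ∑ a, ∑ b, (((if i = a then w b else 0) + η * (if i = b then w a else 0)) *
        conj ((if i = a then w b else 0) + η * (if i = b then w a else 0))) =
        2 * (d + η) * ∑ c, w c * conj (w c) := by
      have h1 : ∑ i : Fin d, ∑ a, ∑ b, (if i = a then w b else 0) * conj (if i = a then w b else 0)
          = d * ∑ c, w c * conj (w c) := by
        simp [apply_ite conj]
      have h2 : ∑ i : Fin d, ∑ a, ∑ b, (if i = b then w a else 0) * conj (if i = b then w a else 0)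
          = d * ∑ c, w c * conj (w c) := by
        simp [apply_ite conj]
      have h3 : ∑ i : Fin d, ∑ a, ∑ b, (if i = a then w b else 0) * conj (if i = b then w a else 0)
          = ∑ c, w c * conj (w c) := by
        simp [apply_ite conj]
      have h4 : ∑ i : Fin d, ∑ a, ∑ b, (if i = b then w a else 0) * conj (if i = a then w b else 0)
          = ∑ c, w c * conj (w c) := by
        simp [apply_ite conj]
      have : ∀ i a b : Fin d,
          ((if i = a then w b else 0) + η * (if i = b then w a else 0)) *
            conj ((if i = a then w b else 0) + η * (if i = b then w a else 0)) =
          (if i = a then w b else 0) * conj (if i = a then w b else 0) +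
          (if i = b then w a else 0) * conj (if i = b then w a else 0) +
          η * ((if i = a then w b else 0) * conj (if i = b then w a else 0)) +
          η * ((if i = b then w a else 0) * conj (if i = a then w b else 0)) := by
        intro i a b
        rw [map_add, map_mul, Complex.conj_ofReal]
        linear_combination
          ((if i = b then w a else 0) * conj (if i = b then w a else 0)) * hη'
      simp_rw [this, Finset.sum_add_distrib, ← Finset.mul_sum]
      rw [h1, h2, h3, h4]
      ring
    apply Complex.ofReal_injective
    push_cast
    simp_rw [Complex.normSq_eq_conj_mul_self, mul_comm (conj _)]
    have : ∀ i a b : Fin d,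
        (((d : ℂ) + η) * L i a b -
          ((if i = a then w b else 0) + η * (if i = b then w a else 0))) *
        conj (((d : ℂ) + η) * L i a b -
          ((if i = a then w b else 0) + η * (if i = b then w a else 0))) =
        (d + η) ^ 2 * (L i a b * conj (L i a b)) -
        (d + η) * (L i a b * conj (if i = a then w b else 0)) -
        (d + η) * (L i a b * conj (η * (if i = b then w a else 0))) -
        (d + η) * ((if i = a then w b else 0) * conj (L i a b)) -
        (d + η) * ((η * (if i = b then w a else 0)) * conj (L i a b)) +
        (((if i = a then w b else 0) + η * (if i = b then w a else 0)) *
        conj ((if i = a then w b else 0) + η * (if i = b then w a else 0))) := by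
      intro i a b
      simp only [map_add, map_sub, map_mul, Complex.conj_ofReal, map_natCast]
      ring
    simp_rw [this, Finset.sum_add_distrib, Finset.sum_sub_distrib, ← Finset.mul_sum]
    rw [hw1, hw2, hwc1, hwc2, hww]
    ring
  have h0 : 0 ≤ ∑ i, ∑ a, ∑ b, Complex.normSq (((d + η : ℝ) : ℂ) * L i a b -
      ((if i = a then w b else 0) + η * (if i = b then w a else 0))) :=
    Finset.sum_nonneg fun i _ => Finset.sum_nonneg fun a _ => Finset.sum_nonneg fun b _ =>
      Complex.normSq_nonneg _
  rw [key] at h0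
  have h1 : 0 ≤ (d + η) * (∑ i, ∑ a, ∑ b, Complex.normSq (L i a b)) -
      2 * ∑ c, Complex.normSq (w c) := by
    refine (mul_nonneg_iff_of_pos_left hpos).mp ?_
    linarith
  linarith

theorem contractionNorm_le {d : ℕ} (hd : 1 ≤ d) {η : ℝ} (hη : η = 1 ∨ η = -1)
    (K : Fin d → Fin d → Fin d → ℂ) :
    contractionNorm η K ≤ (d + η) * swapNorm η K := by
  have hη2 : η ^ 2 = 1 := by rcases hη with rfl | rfl <;> norm_num
  have hη' : (η : ℂ) * η = 1 := by rw [← pow_two]; exact_mod_cast hη2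
  have hd' : (1 : ℝ) ≤ d := by exact_mod_cast hd
  by_cases hpos : 0 < d + η
  · refine contraction_le_of_swap_eq hη2 hpos (fun i a b => K i a b + η * K i b a) ?_
    intro i a b
    linear_combination (-K i b a) * hη'
  · obtain rfl : η = -1 := by
      rcases hη with rfl | rfl
      · exact absurd (by linarith) hpos
      · rfl
    -- Only `d = 1`, `η = -1` is left, where the antisymmetric part vanishes and both sides are
    -- zero.
    obtain rfl : d = 1 := by
      have : (d : ℝ) ≤ 1 := by linarith
      exact le_antisymm (by exact_mod_cast this) hd
    simp [contractionNorm]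

/-- Parallelogram law for `K` and its swap, which have equal norms; `sum_mul_conj_swap_eq` is the
matching polarization identity. -/
theorem sum_normSq_eq {d : ℕ} (K : Fin d → Fin d → Fin d → ℂ) :
    ∑ i, ∑ a, ∑ b, K i a b * conj (K i a b) = ((swapNorm 1 K + swapNorm (-1) K) / 2 : ℝ) := by
  have hs : ∑ i, ∑ a, ∑ b, K i b a * conj (K i b a) = ∑ i, ∑ a, ∑ b, K i a b * conj (K i a b) :=
    Finset.sum_congr rfl fun i _ => Finset.sum_comm
  simp only [swapNorm]
  push_cast
  simp_rw [Complex.normSq_eq_conj_mul_self, mul_comm (conj _)]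
  simp only [map_add, map_neg, add_mul, mul_add, one_mul,
    neg_mul, mul_neg, Finset.sum_add_distrib, Finset.sum_neg_distrib]
  rw [hs]
  ring

theorem sum_mul_conj_swap_eq {d : ℕ} (K : Fin d → Fin d → Fin d → ℂ) :
    ∑ i, ∑ a, ∑ b, K i a b * conj (K i b a) = ((swapNorm 1 K - swapNorm (-1) K) / 2 : ℝ) := by
  have hs : ∑ i, ∑ a, ∑ b, K i b a * conj (K i a b) = ∑ i, ∑ a, ∑ b, K i a b * conj (K i b a) :=
    Finset.sum_congr rfl fun i _ => Finset.sum_comm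
  simp only [swapNorm]
  push_cast
  simp_rw [Complex.normSq_eq_conj_mul_self, mul_comm (conj _)]
  simp only [map_add, map_neg, add_mul, mul_add, one_mul,
    neg_mul, mul_neg, Finset.sum_add_distrib, Finset.sum_neg_distrib]
  rw [hs]
  ring

theorem sum_contractions_eq {d : ℕ} (K : Fin d → Fin d → Fin d → ℂ) :
    ∑ c, (∑ i, K i i c) * conj (∑ i, K i i c) + ∑ c, (∑ i, K i c i) * conj (∑ i, K i c i) =
      ((contractionNorm 1 K + contractionNorm (-1) K) / 2 : ℝ) := by
  simp only [contractionNorm]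
  push_cast
  simp_rw [Complex.normSq_eq_conj_mul_self, mul_comm (conj _)]
  simp only [map_add, map_neg, add_mul, mul_add, one_mul,
    neg_mul, mul_neg, Finset.sum_add_distrib, Finset.sum_neg_distrib]
  ring

theorem contractionNorm_one_eq {d : ℕ} (K : Fin d → Fin d → Fin d → ℂ) :
    ∑ c, (∑ i, (K i i c + K i c i)) * conj (∑ i, (K i i c + K i c i)) =
      (contractionNorm 1 K : ℝ) := by
  simp only [contractionNorm]
  push_cast
  simp_rw [Complex.normSq_eq_conj_mul_self, mul_comm (conj _), one_mul]

/-! ### Averages over two depolarized copies. -/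

/-- The quadratic form `M ↦ ⟨M, (ρ ⊗ ρ) M⟩` on two-index tensors. -/
def twoCopyForm {d : ℕ} (ρ : Matrix (Fin d) (Fin d) ℂ) (M : Fin d → Fin d → ℂ) : ℂ :=
  ∑ a, ∑ b, ∑ a', ∑ b', M a b * (ρ a a' * ρ b b') * conj (M a' b')

theorem depolarizing_pureState_apply {d : ℕ} (δ : ℝ)
    (ψ : Metric.sphere (0 : EuclideanSpace ℂ (Fin d)) 1) (i j : Fin d) :
    depolarizing d δ (pureState ψ.1) i j =
      (1 - δ : ℝ) * (ψ.1 i * conj (ψ.1 j)) + (δ / d : ℝ) * (if i = j then 1 else 0) := by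
  have htr : (pureState ψ.1).trace = 1 := by
    rw [← sum_mul_conj_eq_one ψ]
    rfl
  simp only [depolarizing, LinearMap.add_apply, LinearMap.smul_apply, LinearMap.id_apply,
    LinearMap.smulRight_apply, Matrix.traceLinearMap_apply, htr, one_smul, Matrix.add_apply,
    Matrix.smul_apply, Matrix.one_apply, smul_eq_mul]
  rfl

/-- Expanding `(u vv† + ε)^{⊗2}` into four terms makes each one a sum of squared moduli, ready for
the moment formulas. -/
theorem twoCopyForm_rankOne_add_scalar {d : ℕ} (u ε : ℝ) (v : Fin d → ℂ)
    (ρ : Matrix (Fin d) (Fin d) ℂ)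
    (hρ : ∀ i j, ρ i j = u * (v i * conj (v j)) + ε * (if i = j then 1 else 0))
    (M : Fin d → Fin d → ℂ) :
    twoCopyForm ρ M =
      u ^ 2 * ((∑ a, ∑ b, M a b * (v a * v b)) * conj (∑ a, ∑ b, M a b * (v a * v b))) +
      u * ε * (∑ b, (∑ a, M a b * v a) * conj (∑ a, M a b * v a)) +
      u * ε * (∑ a, (∑ b, M a b * v b) * conj (∑ b, M a b * v b)) +
      ε ^ 2 * ∑ a, ∑ b, M a b * conj (M a b) := by
  have h1 : (∑ a, ∑ b, M a b * (v a * v b)) * conj (∑ a, ∑ b, M a b * (v a * v b)) =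
      ∑ a, ∑ b, ∑ a', ∑ b', M a b * ((v a * conj (v a')) * (v b * conj (v b'))) *
        conj (M a' b') := by
    simp only [map_sum, map_mul, Finset.sum_mul]
    simp only [Finset.mul_sum]
    refine Finset.sum_congr rfl fun a _ => Finset.sum_congr rfl fun b _ =>
      Finset.sum_congr rfl fun i _ => Finset.sum_congr rfl fun j _ => ?_
    ring
  have h2 : ∑ b, (∑ a, M a b * v a) * conj (∑ a, M a b * v a) =
      ∑ a, ∑ b, ∑ a', ∑ b', M a b * ((v a * conj (v a')) * (if b = b' then 1 else 0)) *
        conj (M a' b') := by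
    simp only [mul_ite, mul_one, mul_zero, ite_mul, zero_mul, Finset.sum_ite_eq, Finset.mem_univ,
      if_true]
    rw [Finset.sum_comm]
    simp only [map_sum, map_mul, Finset.sum_mul]
    simp only [Finset.mul_sum]
    refine Finset.sum_congr rfl fun a _ => Finset.sum_congr rfl fun b _ =>
      Finset.sum_congr rfl fun i _ => ?_
    ring
  have h3 : ∑ a, (∑ b, M a b * v b) * conj (∑ b, M a b * v b) =
      ∑ a, ∑ b, ∑ a', ∑ b', M a b * ((if a = a' then 1 else 0) * (v b * conj (v b'))) *
        conj (M a' b') := by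
    simp only [map_sum, map_mul, Finset.sum_mul]
    simp only [Finset.mul_sum]
    refine Finset.sum_congr rfl fun a _ => Finset.sum_congr rfl fun b _ => ?_
    rw [Finset.sum_comm]
    refine Finset.sum_congr rfl fun i _ => ?_
    simp only [mul_ite, mul_zero, ite_mul, zero_mul, one_mul, Finset.sum_ite_eq,
      Finset.mem_univ, if_true]
    ring
  have h4 : ∑ a, ∑ b, M a b * conj (M a b) =
      ∑ a, ∑ b, ∑ a', ∑ b', M a b * ((if a = a' then 1 else 0) * (if b = b' then 1 else 0)) *
        conj (M a' b') := by
    simp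
  rw [h1, h2, h3, h4, twoCopyForm]
  simp only [Finset.mul_sum, ← Finset.sum_add_distrib]
  refine Finset.sum_congr rfl fun a _ => Finset.sum_congr rfl fun b _ =>
      Finset.sum_congr rfl fun i _ => Finset.sum_congr rfl fun j _ => ?_
  rw [hρ, hρ]
  ring

theorem continuous_twoCopyForm {d : ℕ} (δ : ℝ)
    {M : Metric.sphere (0 : EuclideanSpace ℂ (Fin d)) 1 → Fin d → Fin d → ℂ}
    (hM : ∀ a b, Continuous fun ψ => M ψ a b) :
    Continuous fun ψ => twoCopyForm (depolarizing d δ (pureState ψ.1)) (M ψ) := by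
  simp only [twoCopyForm, depolarizing_pureState_apply]
  fun_prop

/-- `∫ tr[K ρ_ψ^{⊗2} K†] dψ` in terms of the symmetric and antisymmetric parts of `K`. -/
theorem integral_trace_kraus {d : ℕ} (hd : 1 ≤ d) (δ : ℝ) (K : Fin d → Fin d → Fin d → ℂ) :
    ∫ ψ, ∑ i, twoCopyForm (depolarizing d δ (pureState ψ.1)) (K i) ∂haarSphere d =
      ((1 - δ) ^ 2 * swapNorm 1 K / (d * (d + 1)) +
        (2 * (1 - δ) * (δ / d) / d + (δ / d) ^ 2) * ((swapNorm 1 K + swapNorm (-1) K) / 2) :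
          ℝ) := by
  have := isProbabilityMeasure_haarSphere hd
  rw [integral_haarSphere_sum hd (fun i ψ => twoCopyForm (depolarizing d δ (pureState ψ.1)) (K i))
    fun i => continuous_twoCopyForm δ fun a b => continuous_const]
  have hK : ∀ i, ∫ ψ, twoCopyForm (depolarizing d δ (pureState ψ.1)) (K i) ∂haarSphere d =
      (1 - δ : ℝ) ^ 2 * (((∑ a, ∑ b, K i a b * conj (K i a b)) +
        ∑ a, ∑ b, K i a b * conj (K i b a)) / (d * (d + 1))) +
      (2 * (1 - δ : ℝ) * (δ / d : ℝ) / d + (δ / d : ℝ) ^ 2) *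
        ∑ a, ∑ b, K i a b * conj (K i a b) := by
    intro i
    simp_rw [twoCopyForm_rankOne_add_scalar (1 - δ) (δ / d) _ _
      (depolarizing_pureState_apply δ _)]
    rw [integral_add (integrable_haarSphere hd (by fun_prop))
        (integrable_haarSphere hd (by fun_prop)),
      integral_add (integrable_haarSphere hd (by fun_prop))
        (integrable_haarSphere hd (by fun_prop)),
      integral_add (integrable_haarSphere hd (by fun_prop))
        (integrable_haarSphere hd (by fun_prop))]
    simp only [integral_const_mul]
    rw [integral_normSq_quadratic hd, integral_haarSphere_sum hd _ (fun b => by fun_prop),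
      integral_haarSphere_sum hd _ (fun b => by fun_prop)]
    simp only [integral_normSq_linear hd]
    rw [← Finset.sum_div, ← Finset.sum_div, Finset.sum_comm (f := fun b a => K i a b * conj _),
      integral_const]
    simp
    ring
  simp_rw [hK]
  rw [Finset.sum_add_distrib, ← Finset.mul_sum, ← Finset.mul_sum, ← Finset.sum_div,
    Finset.sum_add_distrib, sum_normSq_eq, sum_mul_conj_swap_eq]
  push_cast
  ring

/-- `∫ ⟨ψ| K ρ_ψ^{⊗2} K† |ψ⟩ dψ` in terms of the symmetric and antisymmetric parts of `K`. -/
theorem integral_overlap_kraus {d : ℕ} (hd : 1 ≤ d) (δ : ℝ) (K : Fin d → Fin d → Fin d → ℂ) :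
    ∫ ψ, twoCopyForm (depolarizing d δ (pureState ψ.1))
        (fun a b => ∑ i, conj (ψ.1 i) * K i a b) ∂haarSphere d =
      ((1 - δ) ^ 2 * (swapNorm 1 K + contractionNorm 1 K) / (d * (d + 1) * (d + 2)) +
        (1 - δ) * (δ / d) * (swapNorm 1 K + swapNorm (-1) K +
          (contractionNorm 1 K + contractionNorm (-1) K) / 2) / (d * (d + 1)) +
        (δ / d) ^ 2 * ((swapNorm 1 K + swapNorm (-1) K) / 2) / d : ℝ) := by
  have h1 : ∀ ψ : Metric.sphere (0 : EuclideanSpace ℂ (Fin d)) 1,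
      ∑ a, ∑ b, (∑ i, conj (ψ.1 i) * K i a b) * (ψ.1 a * ψ.1 b) =
      ∑ i, ∑ a, ∑ b, K i a b * (conj (ψ.1 i) * ψ.1 a * ψ.1 b) := by
    intro ψ
    simp only [Finset.sum_mul]
    refine (Finset.sum_congr rfl fun a _ => Finset.sum_comm).trans (Finset.sum_comm.trans ?_)
    refine Finset.sum_congr rfl fun i _ => Finset.sum_congr rfl fun a _ =>
      Finset.sum_congr rfl fun b _ => ?_
    ring
  have h2 : ∀ (ψ : Metric.sphere (0 : EuclideanSpace ℂ (Fin d)) 1) (b : Fin d),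
      ∑ a, (∑ i, conj (ψ.1 i) * K i a b) * ψ.1 a =
      ∑ i, ∑ a, K i a b * (conj (ψ.1 i) * ψ.1 a) := by
    intro ψ b
    simp only [Finset.sum_mul]
    rw [Finset.sum_comm]
    refine Finset.sum_congr rfl fun i _ => Finset.sum_congr rfl fun a _ => ?_
    ring
  have h3 : ∀ (ψ : Metric.sphere (0 : EuclideanSpace ℂ (Fin d)) 1) (a : Fin d),
      ∑ b, (∑ i, conj (ψ.1 i) * K i a b) * ψ.1 b =
      ∑ i, ∑ b, K i a b * (conj (ψ.1 i) * ψ.1 b) := by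
    intro ψ a
    simp only [Finset.sum_mul]
    rw [Finset.sum_comm]
    refine Finset.sum_congr rfl fun i _ => Finset.sum_congr rfl fun a _ => ?_
    ring
  -- Conjugation makes the form linear in `ψ`, so that `integral_normSq_linear` applies.
  have h4 : ∀ (ψ : Metric.sphere (0 : EuclideanSpace ℂ (Fin d)) 1) (a b : Fin d),
      (∑ i, conj (ψ.1 i) * K i a b) * conj (∑ i, conj (ψ.1 i) * K i a b) =
      (∑ i, conj (K i a b) * ψ.1 i) * conj (∑ i, conj (K i a b) * ψ.1 i) := by
    intro ψ a b
    simp only [map_sum, map_mul, Complex.conj_conj]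
    rw [mul_comm]
    simp only [mul_comm]
  simp_rw [twoCopyForm_rankOne_add_scalar (1 - δ) (δ / d) _ _
      (depolarizing_pureState_apply δ _), h1, h2, h3, h4]
  rw [integral_add (integrable_haarSphere hd (by fun_prop))
        (integrable_haarSphere hd (by fun_prop)),
      integral_add (integrable_haarSphere hd (by fun_prop))
        (integrable_haarSphere hd (by fun_prop)),
      integral_add (integrable_haarSphere hd (by fun_prop))
        (integrable_haarSphere hd (by fun_prop))]
  simp only [integral_const_mul]
  rw [integral_normSq_cubic hd]
  simp (disch := intros; fun_prop) only [integral_haarSphere_sum hd,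
    integral_normSq_sesquilinear hd, integral_normSq_linear hd, Complex.conj_conj,
    ← Finset.sum_div, Finset.sum_add_distrib]
  have hS := sum_normSq_eq K
  have hS1 : ∑ b, ∑ i, ∑ a, K i a b * conj (K i a b) = ∑ i, ∑ a, ∑ b, K i a b * conj (K i a b) := by
    rw [Finset.sum_comm]
    exact Finset.sum_congr rfl fun i _ => Finset.sum_comm
  have hS2 : ∑ a, ∑ i, ∑ b, K i a b * conj (K i a b) = ∑ i, ∑ a, ∑ b, K i a b * conj (K i a b) :=
    Finset.sum_comm
  have hS3 : ∑ a, ∑ b, ∑ i, conj (K i a b) * K i a b = ∑ i, ∑ a, ∑ b, K i a b * conj (K i a b) := by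
    rw [← hS2]
    refine Finset.sum_congr rfl fun a _ => ?_
    rw [Finset.sum_comm]
    simp only [mul_comm]
  have hW := contractionNorm_one_eq K
  simp only [Finset.sum_add_distrib] at hW
  have hT := sum_contractions_eq K
  rw [hS1, hS2, hS3, hS, sum_mul_conj_swap_eq, hW]
  push_cast at hT ⊢
  linear_combination ((1 - δ : ℂ) * (δ / d) / (d * (d + 1))) * hT

/-! ### The scalar inequality behind the upper bound. -/

theorem p2_eq {d : ℕ} (hd : 1 ≤ d) (δ : ℝ) :
    p2 d δ = (1 + lam0 d δ ^ 2 + (d - 1) * (δ / d) ^ 2) / 2 := by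
  obtain ⟨n, rfl⟩ : ∃ n, d = n + 1 := ⟨d - 1, by omega⟩
  rw [p2, eigenvalueMatrix, Matrix.diagonal_pow, Matrix.trace_diagonal, Fin.sum_univ_succ]
  simp
  ring

theorem lam0_eq {d : ℕ} (hd : 1 ≤ d) (δ : ℝ) : lam0 d δ = 1 - δ + δ / d := by
  have : (d : ℝ) ≠ 0 := by exact_mod_cast (by omega : d ≠ 0)
  rw [lam0]
  field_simp
  ring

theorem p2_pos {d : ℕ} (hd : 1 ≤ d) (δ : ℝ) : 0 < p2 d δ := by
  have : (1 : ℝ) ≤ d := by exact_mod_cast hd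
  rw [p2_eq hd]
  have := mul_nonneg (sub_nonneg.mpr this) (sq_nonneg (δ / d))
  positivity

/-- Once `P` and `Q` are replaced by their bounds, the `x` coefficients of the two sides agree, so
only the `y` coefficients need comparing. -/
theorem overlap_le_of_swap_bounds {d : ℕ} (hd : 1 ≤ d) {δ : ℝ} (hδ : δ ∈ Set.Icc (0 : ℝ) 1)
    {x y P Q : ℝ} (hy : 0 ≤ y) (hP : P ≤ (d + 1) * x) (hQ : Q ≤ (d + -1) * y) :
    (1 - δ) ^ 2 * (x + P) / (d * (d + 1) * (d + 2)) +
        (1 - δ) * (δ / d) * (x + y + (P + Q) / 2) / (d * (d + 1)) +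
        (δ / d) ^ 2 * ((x + y) / 2) / d ≤
      f2 d δ * ((1 - δ) ^ 2 * x / (d * (d + 1)) +
        (2 * (1 - δ) * (δ / d) / d + (δ / d) ^ 2) * ((x + y) / 2)) := by
  have hd' : (1 : ℝ) ≤ d := by exact_mod_cast hd
  have hd0 : (0 : ℝ) < d := by linarith
  have hp := p2_pos hd δ
  have hp2 := p2_eq hd δ
  rw [f2]
  obtain ⟨ε, rfl⟩ : ∃ ε, δ = d * ε := ⟨δ / d, by field_simp⟩
  have hl := lam0_eq hd (d * ε)
  set l := lam0 d (d * ε)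
  set p := p2 d (d * ε)
  have hε : (d * ε) / d = ε := by field_simp
  rw [hε] at hl hp2 ⊢
  have hε0 : 0 ≤ ε := nonneg_of_mul_nonneg_right hδ.1 hd0
  have hu : 0 ≤ 1 - d * ε := sub_nonneg.mpr hδ.2
  set u := 1 - d * ε with hu_def
  have hdε : (d : ℝ) * ε = 1 - u := by rw [hu_def]; ring
  have hl0 : 0 ≤ l := by rw [hl]; positivity
  have hA : u ^ 2 * (x + P) / (d * (d + 1) * (d + 2)) +
        u * ε * (x + y + (P + Q) / 2) / (d * (d + 1)) + ε ^ 2 * ((x + y) / 2) / d ≤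
      (l + l ^ 2) / (2 * (d * (d + 1))) * x + ε * l / (2 * d) * y := by
    calc _ ≤ u ^ 2 * (x + (d + 1) * x) / (d * (d + 1) * (d + 2)) +
        u * ε * (x + y + ((d + 1) * x + (d + -1) * y) / 2) / (d * (d + 1)) +
          ε ^ 2 * ((x + y) / 2) / d := by gcongr
      _ = _ := by
        rw [hl, hu_def]
        field_simp
        ring
  have hB : u ^ 2 * x / (d * (d + 1)) + (2 * u * ε / d + ε ^ 2) * ((x + y) / 2) =
      p / (d * (d + 1)) * x + (2 * u * ε + d * ε ^ 2) / (2 * d) * y := by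
    rw [hp2, hl, hu_def]
    field_simp
    ring
  -- Cross-multiplied comparison of the antisymmetric ratio with `f2`; the gap is exactly `2 ε l u`.
  have hC : ε * l * (2 * p) ≤ (l + l ^ 2) * (2 * u * ε + d * ε ^ 2) := by
    have : (l + l ^ 2) * (2 * u * ε + d * ε ^ 2) - ε * l * (2 * p) = 2 * (ε * l * u) := by
      rw [hp2, hl, hu_def]
      ring
    have : 0 ≤ ε * l * u := by positivity
    linarith
  rw [hB]
  refine hA.trans ?_
  have h1 : 1 / (2 * p) * (l + l ^ 2) * (p / (d * (d + 1)) * x +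
      (2 * u * ε + d * ε ^ 2) / (2 * d) * y) =
      (l + l ^ 2) / (2 * (d * (d + 1))) * x +
      ((l + l ^ 2) * (2 * u * ε + d * ε ^ 2)) / (2 * p) / (2 * d) * y := by
    field_simp
  have hD : ε * l ≤ (l + l ^ 2) * (2 * u * ε + d * ε ^ 2) / (2 * p) :=
    (le_div_iff₀ (by positivity)).mpr hC
  rw [h1]
  gcongr

/-! ### Kraus decompositions and compactness of the set of CPTN maps. -/

section Kraus

variable {m n κ : Type*} [Fintype m] [Fintype κ]

/-- The map `X ↦ ∑ₗ Kₗ X Kₗ†`. -/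
def krausMap (K : κ → Matrix n m ℂ) : Matrix m m ℂ →ₗ[ℂ] Matrix n n ℂ where
  toFun X := ∑ l, K l * X * (K l)ᴴ
  map_add' X Y := by simp [Matrix.mul_add, Matrix.add_mul, Finset.sum_add_distrib]
  map_smul' c X := by simp [Finset.smul_sum]

theorem krausMap_apply (K : κ → Matrix n m ℂ) (X : Matrix m m ℂ) :
    krausMap K X = ∑ l, K l * X * (K l)ᴴ := rfl

theorem mul_mul_conjTranspose_apply (K : Matrix n m ℂ) (X : Matrix m m ℂ) (i j : n) :
    (K * X * Kᴴ) i j = ∑ a, ∑ b, K i a * X a b * conj (K j b) := by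
  simp only [Matrix.mul_apply, Finset.sum_mul, Matrix.conjTranspose_apply]
  rw [Finset.sum_comm]
  rfl

theorem krausMap_single [DecidableEq m] (K : κ → Matrix n m ℂ) (a b : m) (p q : n) :
    krausMap K (Matrix.single a b 1) p q = ∑ l, K l p a * conj (K l q b) := by
  rw [krausMap_apply, Matrix.sum_apply]
  refine Finset.sum_congr rfl fun l _ => ?_
  rw [mul_mul_conjTranspose_apply]
  simp [Matrix.single_apply, ite_and]

theorem linearMap_ext_single [DecidableEq m] {E F : Matrix m m ℂ →ₗ[ℂ] Matrix n n ℂ}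
    (h : ∀ a b, E (Matrix.single a b 1) = F (Matrix.single a b 1)) : E = F := by
  refine Matrix.ext_linearMap ℂ fun a b => LinearMap.ext_ring ?_
  simpa using h a b

variable [Fintype n]

theorem isCompletelyPositive_krausMap (K : κ → Matrix n m ℂ) :
    IsCompletelyPositive (krausMap K) := by
  intro k M hM
  classical
  have : (Matrix.of fun x y : Fin k × n =>
      krausMap K (Matrix.of fun a b => M (x.1, a) (y.1, b)) x.2 y.2) =
      ∑ l, (Matrix.of fun (x : Fin k × n) (z : Fin k × m) =>
          if x.1 = z.1 then K l x.2 z.2 else 0) * M *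
        (Matrix.of fun (x : Fin k × n) (z : Fin k × m) =>
          if x.1 = z.1 then K l x.2 z.2 else 0)ᴴ := by
    ext x y
    rw [Matrix.of_apply, krausMap_apply, Matrix.sum_apply, Matrix.sum_apply]
    refine Finset.sum_congr rfl fun l _ => ?_
    rw [mul_mul_conjTranspose_apply, mul_mul_conjTranspose_apply, Fintype.sum_prod_type,
      Finset.sum_eq_single x.1]
    · refine Finset.sum_congr rfl fun a _ => ?_
      rw [Fintype.sum_prod_type, Finset.sum_eq_single y.1]
      · simp
      · intro j _ hj
        simp [hj.symm]
      · simp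
    · intro i _ hi
      simp [hi.symm]
    · simp
  rw [this]
  exact Matrix.posSemidef_sum _ fun l _ => hM.mul_mul_conjTranspose_same _

/-- Choi's argument: the ampliation applied to an unnormalized maximally entangled state is positive
semidefinite, and the vectors of a rank-one decomposition, reshaped, are Kraus operators. -/
theorem IsCompletelyPositive.exists_krausMap_eq {E : Matrix m m ℂ →ₗ[ℂ] Matrix n n ℂ}
    (hE : IsCompletelyPositive E) :
    ∃ (r : ℕ) (K : Fin r → Matrix n m ℂ), E = krausMap K := by
  classical
  let e := Fintype.equivFin m
  let v : Fin (Fintype.card m) × m → ℂ := fun x => if x.1 = e x.2 then 1 else 0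
  have hJ := hE _ _ (Matrix.posSemidef_vecMulVec_self_star v)
  obtain ⟨r, w, hw⟩ := Matrix.posSemidef_iff_eq_sum_vecMulVec.mp hJ
  refine ⟨r, fun l => Matrix.of fun p a => w l (e a, p), ?_⟩
  refine linearMap_ext_single fun a b => ?_
  ext p q
  rw [krausMap_single]
  have h := congrFun (congrFun hw (e a, p)) (e b, q)
  rw [Matrix.sum_apply] at h
  have hs : (Matrix.of fun a' b' => Matrix.vecMulVec v (star v) (e a, a') (e b, b')) =
      Matrix.single a b 1 := by
    ext a' b'
    simp [v, Matrix.vecMulVec_apply, Matrix.single_apply, ite_and]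
    split_ifs <;> rfl
  rw [Matrix.of_apply, hs] at h
  exact h

/-- The boundedness half of compactness: trace non-increase on diagonal matrix units bounds the
columns of the Kraus operators, and AM-GM handles the remaining entries. -/
theorem IsCPTN.norm_apply_single_le [DecidableEq m] {E : Matrix m m ℂ →ₗ[ℂ] Matrix n n ℂ}
    (hE : IsCPTN E) (a b : m) (p q : n) : ‖E (Matrix.single a b 1) p q‖ ≤ 1 := by
  obtain ⟨r, K, rfl⟩ := hE.1.exists_krausMap_eq
  have hdiag : ∀ (a : m) (p : n), ∑ l, ‖K l p a‖ ^ 2 ≤ 1 := by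
    intro a p
    have hpos : (Matrix.single a a (1 : ℂ)).PosSemidef := by
      have := Matrix.posSemidef_vecMulVec_self_star (Pi.single a (1 : ℂ))
      convert this
      ext i j
      simp [Matrix.single_apply, Matrix.vecMulVec_apply, Pi.single_apply, ite_and, @eq_comm _ a]
      split_ifs <;> rfl
    have h := hE.2 _ hpos
    have hre : ∀ q, (krausMap K (Matrix.single a a 1) q q).re = ∑ l, ‖K l q a‖ ^ 2 := by
      intro q
      rw [krausMap_single, Complex.re_sum]
      refine Finset.sum_congr rfl fun l _ => ?_
      rw [Complex.mul_conj, Complex.normSq_eq_norm_sq, Complex.ofReal_re]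
    rw [Matrix.trace_single_eq_same, Complex.one_re, Matrix.trace, Complex.re_sum] at h
    refine le_trans ?_ h
    rw [← hre]
    refine Finset.single_le_sum (f := fun q => (krausMap K (Matrix.single a a 1) q q).re)
      (fun q _ => ?_) (Finset.mem_univ p)
    rw [hre]
    positivity
  rw [krausMap_single]
  calc ‖∑ l, K l p a * conj (K l q b)‖ ≤ ∑ l, (‖K l p a‖ ^ 2 + ‖K l q b‖ ^ 2) / 2 := by
        refine (norm_sum_le _ _).trans (Finset.sum_le_sum fun l _ => ?_)
        rw [norm_mul, Complex.norm_conj]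
        linarith [two_mul_le_add_sq ‖K l p a‖ ‖K l q b‖]
    _ ≤ 1 := by
        rw [← Finset.sum_div, Finset.sum_add_distrib]
        linarith [hdiag a p, hdiag b q]

theorem IsCPTN.smul {E : Matrix m m ℂ →ₗ[ℂ] Matrix n n ℂ} (hE : IsCPTN E) {c : ℝ}
    (hc0 : 0 ≤ c) (hc1 : c ≤ 1) : IsCPTN (c • E) := by
  refine ⟨fun k M hM => ?_, fun ρ hρ => ?_⟩
  · have h := (hE.1 k M hM).smul hc0
    exact h
  · have h := hE.2 ρ hρ
    have h0 : 0 ≤ ρ.trace.re := (Complex.nonneg_iff.mp hρ.trace_nonneg).1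
    rw [LinearMap.smul_apply, Matrix.trace_smul, Complex.real_smul, Complex.re_ofReal_mul]
    nlinarith

theorem isClosed_setOf_posSemidef {ι : Type*} [Fintype ι] :
    IsClosed {M : Matrix ι ι ℂ | M.PosSemidef} := by
  have : {M : Matrix ι ι ℂ | M.PosSemidef} =
      {M | Mᴴ = M} ∩ ⋂ x : ι → ℂ, {M | 0 ≤ star x ⬝ᵥ (M *ᵥ x)} := by
    ext M
    simp only [Matrix.posSemidef_iff_dotProduct_mulVec, mem_ofPred_eq, mem_inter_iff, mem_iInter]
    rfl
  rw [this]
  refine (isClosed_eq (by fun_prop) (by fun_prop)).inter (isClosed_iInter fun x => ?_)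
  exact isClosed_le continuous_const (by fun_prop)

/-- The defining conditions are closed, and the injective map to matrix entries sends the set into a
unit ball of the sup norm. -/
theorem isCompact_setOf_isCPTN {r : ℕ}
    (Φ : (Fin r → ℂ) ≃ₗ[ℂ] (Matrix m m ℂ →ₗ[ℂ] Matrix n n ℂ)) :
    IsCompact {c | IsCPTN (Φ c)} := by
  classical
  have hcont : ∀ (X : Matrix m m ℂ) (i j : n), Continuous fun c => Φ c X i j := by
    intro X i j
    let f : (Fin r → ℂ) →ₗ[ℂ] ℂ :=
      { toFun := fun c => Φ c X i j
        map_add' := fun c c' => by simp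
        map_smul' := fun t c => by simp }
    exact f.continuous_of_finiteDimensional
  let Ψ : (Fin r → ℂ) →ₗ[ℂ] (m → m → n → n → ℂ) :=
    { toFun := fun c a b p q => Φ c (Matrix.single a b 1) p q
      map_add' := fun c c' => by ext; simp
      map_smul' := fun t c => by ext; simp }
  have hΨ : Function.Injective Ψ := by
    intro c c' h
    refine Φ.injective (linearMap_ext_single fun a b => ?_)
    ext p q
    exact congrFun (congrFun (congrFun (congrFun h a) b) p) q
  have hemb := LinearMap.isClosedEmbedding_of_injective (LinearMap.ker_eq_bot.mpr hΨ)
  refine (hemb.isCompact_preimage (isCompact_closedBall 0 1)).of_isClosed_subset ?_ ?_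
  · have : {c | IsCPTN (Φ c)} =
      (⋂ (k : ℕ) (M : Matrix (Fin k × m) (Fin k × m) ℂ) (_ : M.PosSemidef),
        {c | (Matrix.of fun x y : Fin k × n =>
          Φ c (Matrix.of fun a b => M (x.1, a) (y.1, b)) x.2 y.2).PosSemidef}) ∩
      ⋂ (ρ : Matrix m m ℂ) (_ : ρ.PosSemidef), {c | (Φ c ρ).trace.re ≤ ρ.trace.re} := by
      ext c
      simp [IsCPTN, IsCompletelyPositive]
    rw [this]
    refine (isClosed_iInter fun k => isClosed_iInter fun M => isClosed_iInter fun hM =>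
      isClosed_setOf_posSemidef.preimage ?_).inter
      (isClosed_iInter fun ρ => isClosed_iInter fun hρ => isClosed_le ?_ continuous_const)
    · exact continuous_matrix fun x y => hcont _ _ _
    · exact Complex.continuous_re.comp (continuous_finsetSum _ fun i _ => hcont _ _ _)
  · intro c hc
    rw [mem_preimage, mem_closedBall_zero_iff]
    refine (pi_norm_le_iff_of_nonneg zero_le_one).mpr fun a =>
      (pi_norm_le_iff_of_nonneg zero_le_one).mpr fun b =>
      (pi_norm_le_iff_of_nonneg zero_le_one).mpr fun p =>
      (pi_norm_le_iff_of_nonneg zero_le_one).mpr fun q => ?_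
    exact IsCPTN.norm_apply_single_le hc a b p q

end Kraus

/-! ### Overlap and success probability as linear functionals of the protocol, and the upper bound.
-/

theorem sum_fin_two_fun {ι M : Type*} [Fintype ι] [AddCommMonoid M] (f : (Fin 2 → ι) → M) :
    ∑ a, f a = ∑ x, ∑ y, f ![x, y] := by
  rw [← Equiv.sum_comp (finTwoArrowEquiv ι).symm, Fintype.sum_prod_type]
  rfl

theorem continuous_outputState {d n : ℕ} (δ : ℝ)
    (E : Matrix (Fin n → Fin d) (Fin n → Fin d) ℂ →ₗ[ℂ] Matrix (Fin d) (Fin d) ℂ) :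
    Continuous fun ψ : Metric.sphere (0 : EuclideanSpace ℂ (Fin d)) 1 =>
      outputState (depolarizing d δ) E ψ.1 := by
  refine E.continuous_of_finiteDimensional.comp (continuous_matrix fun a b => ?_)
  simp only [tensorPower, Matrix.of_apply, depolarizing_pureState_apply]
  fun_prop

theorem continuous_pureState {d : ℕ} :
    Continuous fun ψ : Metric.sphere (0 : EuclideanSpace ℂ (Fin d)) 1 => pureState ψ.1 := by
  refine continuous_matrix fun a b => ?_
  simp only [pureState, Matrix.of_apply]
  fun_prop

/-- The average of `Re tr[σ_ψ A_ψ]` as a linear functional of the protocol. -/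
def averageFunctional {d : ℕ} (hd : 1 ≤ d) (n : ℕ) (δ : ℝ)
    (A : Metric.sphere (0 : EuclideanSpace ℂ (Fin d)) 1 → Matrix (Fin d) (Fin d) ℂ)
    (hA : Continuous A) :
    (Matrix (Fin n → Fin d) (Fin n → Fin d) ℂ →ₗ[ℂ] Matrix (Fin d) (Fin d) ℂ) →ₗ[ℝ] ℝ where
  toFun E := ∫ ψ, (outputState (depolarizing d δ) E ψ.1 * A ψ).trace.re ∂haarSphere d
  map_add' E F := by
    have hint : ∀ E : Matrix (Fin n → Fin d) (Fin n → Fin d) ℂ →ₗ[ℂ] Matrix (Fin d) (Fin d) ℂ,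
        Integrable (fun ψ => (outputState (depolarizing d δ) E ψ.1 * A ψ).trace.re)
        (haarSphere d) := fun E =>
      integrable_haarSphere hd
        (Complex.continuous_re.comp ((continuous_outputState δ E).matrix_mul hA).matrix_trace)
    rw [← integral_add (hint E) (hint F)]
    refine integral_congr_ae (Filter.Eventually.of_forall fun ψ => ?_)
    simp [outputState, Matrix.add_mul]
  map_smul' c E := by
    rw [RingHom.id_apply, smul_eq_mul, ← integral_const_mul]
    refine integral_congr_ae (Filter.Eventually.of_forall fun ψ => ?_)
    simp [outputState]

theorem averageFunctional_pureState {d : ℕ} (hd : 1 ≤ d) (n : ℕ) (δ : ℝ)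
    (E : Matrix (Fin n → Fin d) (Fin n → Fin d) ℂ →ₗ[ℂ] Matrix (Fin d) (Fin d) ℂ) :
    averageFunctional hd n δ _ continuous_pureState E = averageOverlap (depolarizing d δ) E :=
  rfl

theorem averageFunctional_one {d : ℕ} (hd : 1 ≤ d) (n : ℕ) (δ : ℝ)
    (E : Matrix (Fin n → Fin d) (Fin n → Fin d) ℂ →ₗ[ℂ] Matrix (Fin d) (Fin d) ℂ) :
    averageFunctional hd n δ (fun _ => 1) continuous_const E =
      successProbability (depolarizing d δ) E := by
  simp [averageFunctional, successProbability]

theorem averageOverlap_smul {d n : ℕ} (hd : 1 ≤ d) (δ c : ℝ)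
    (E : Matrix (Fin n → Fin d) (Fin n → Fin d) ℂ →ₗ[ℂ] Matrix (Fin d) (Fin d) ℂ) :
    averageOverlap (depolarizing d δ) (c • E) = c * averageOverlap (depolarizing d δ) E := by
  rw [← averageFunctional_pureState hd, map_smul, averageFunctional_pureState, smul_eq_mul]

theorem successProbability_smul {d n : ℕ} (hd : 1 ≤ d) (δ c : ℝ)
    (E : Matrix (Fin n → Fin d) (Fin n → Fin d) ℂ →ₗ[ℂ] Matrix (Fin d) (Fin d) ℂ) :
    successProbability (depolarizing d δ) (c • E) =
      c * successProbability (depolarizing d δ) E := by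
  rw [← averageFunctional_one hd, map_smul, averageFunctional_one, smul_eq_mul]

theorem isCompact_fidelitySet {d : ℕ} (hd : 1 ≤ d) (n : ℕ) (δ p : ℝ) :
    IsCompact (fidelitySet (depolarizing d δ) n p) := by
  let V := Matrix (Fin n → Fin d) (Fin n → Fin d) ℂ →ₗ[ℂ] Matrix (Fin d) (Fin d) ℂ
  let Φ : (Fin (Module.finrank ℂ V) → ℂ) ≃ₗ[ℂ] V := (Module.finBasis ℂ V).equivFun.symm
  have hcont : ∀ L : V →ₗ[ℝ] ℝ, Continuous fun c => L (Φ c) := fun L =>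
    (L ∘ₗ Φ.toLinearMap.restrictScalars ℝ).continuous_of_finiteDimensional
  have hO : Continuous fun c => averageOverlap (depolarizing d δ) (Φ c) :=
    hcont (averageFunctional hd n δ _ continuous_pureState)
  have hS : Continuous fun c => successProbability (depolarizing d δ) (Φ c) := by
    simp_rw [← averageFunctional_one hd]
    exact hcont _
  -- On the slice of success probability `p` the denominator is constant, so continuity of the
  -- quotient needs no condition on `p`.
  have himage : fidelitySet (depolarizing d δ) n p =
      (fun c => averageOverlap (depolarizing d δ) (Φ c) / p) ''
        ({c | IsCPTN (Φ c)} ∩ {c | successProbability (depolarizing d δ) (Φ c) = p}) := by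
    ext f
    constructor
    · rintro ⟨E, hE, hp, rfl⟩
      refine ⟨Φ.symm E, ⟨?_, ?_⟩, ?_⟩
      · simpa using hE
      · simpa using hp
      · simp [hp]
    · rintro ⟨c, ⟨hE, hp⟩, rfl⟩
      refine ⟨Φ c, hE, hp, ?_⟩
      rw [mem_ofPred_eq] at hp
      simp only [hp]
  rw [himage]
  exact ((isCompact_setOf_isCPTN Φ).inter_right (isClosed_eq hS continuous_const)).image
    (hO.div_const p)

theorem trace_kraus_tensorPower {d : ℕ} (ρ : Matrix (Fin d) (Fin d) ℂ)
    (K : Matrix (Fin d) (Fin 2 → Fin d) ℂ) :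
    (K * tensorPower 2 ρ * Kᴴ).trace = ∑ i, twoCopyForm ρ fun a b => K i ![a, b] := by
  simp only [Matrix.trace, Matrix.diag_apply, mul_mul_conjTranspose_apply, sum_fin_two_fun,
    twoCopyForm, tensorPower, Matrix.of_apply, Fin.prod_univ_two]
  rfl

theorem trace_mul_pureState {d : ℕ} {m : Type*} [Fintype m] (K : Matrix (Fin d) m ℂ)
    (X : Matrix m m ℂ) (ψ : EuclideanSpace ℂ (Fin d)) :
    (K * X * Kᴴ * pureState ψ).trace =
      ∑ a, ∑ b, (∑ i, conj (ψ i) * K i a) * X a b * conj (∑ i, conj (ψ i) * K i b) := by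
  have h1 : (K * X * Kᴴ * pureState ψ).trace =
      ∑ i, ∑ j, ∑ a, ∑ b, conj (ψ i) * K i a * X a b * (ψ j * conj (K j b)) := by
    refine Finset.sum_congr rfl fun i _ => ?_
    rw [Matrix.diag_apply, Matrix.mul_apply]
    refine Finset.sum_congr rfl fun j _ => ?_
    rw [mul_mul_conjTranspose_apply, Finset.sum_mul]
    refine Finset.sum_congr rfl fun a _ => ?_
    rw [Finset.sum_mul]
    refine Finset.sum_congr rfl fun b _ => ?_
    rw [pureState, Matrix.of_apply, Complex.star_def]
    ring
  rw [h1]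
  refine (Finset.sum_congr rfl fun i _ => Finset.sum_comm.trans
    (Finset.sum_congr rfl fun a _ => Finset.sum_comm)).trans
    (Finset.sum_comm.trans (Finset.sum_congr rfl fun a _ => Finset.sum_comm.trans
      (Finset.sum_congr rfl fun b _ => ?_)))
  simp only [map_sum, map_mul, Complex.conj_conj, Finset.sum_mul]
  simp only [Finset.mul_sum]

theorem trace_kraus_tensorPower_mul_pureState {d : ℕ} (ρ : Matrix (Fin d) (Fin d) ℂ)
    (K : Matrix (Fin d) (Fin 2 → Fin d) ℂ) (ψ : EuclideanSpace ℂ (Fin d)) :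
    (K * tensorPower 2 ρ * Kᴴ * pureState ψ).trace =
      twoCopyForm ρ fun a b => ∑ i, conj (ψ i) * K i ![a, b] := by
  simp only [trace_mul_pureState, sum_fin_two_fun, twoCopyForm, tensorPower, Matrix.of_apply,
    Fin.prod_univ_two]
  rfl

/-- The inequality is linear in `E`, so it may be checked on each Kraus operator. Complete
positivity alone is enough. -/
theorem averageOverlap_le {d : ℕ} (hd : 1 ≤ d) {δ : ℝ} (hδ : δ ∈ Set.Icc (0 : ℝ) 1)
    {E : Matrix (Fin 2 → Fin d) (Fin 2 → Fin d) ℂ →ₗ[ℂ] Matrix (Fin d) (Fin d) ℂ}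
    (hE : IsCompletelyPositive E) :
    averageOverlap (depolarizing d δ) E ≤ f2 d δ * successProbability (depolarizing d δ) E := by
  obtain ⟨r, K, rfl⟩ := hE.exists_krausMap_eq
  have hsum : krausMap K = ∑ l, krausMap fun _ : Unit => K l := by
    refine LinearMap.ext fun X => ?_
    simp [krausMap_apply]
  have hone : ∀ K : Matrix (Fin d) (Fin 2 → Fin d) ℂ,
      averageOverlap (depolarizing d δ) (krausMap fun _ : Unit => K) ≤
        f2 d δ * successProbability (depolarizing d δ) (krausMap fun _ : Unit => K) := by
    intro K
    have hre : ∀ f : Metric.sphere (0 : EuclideanSpace ℂ (Fin d)) 1 → ℂ, Continuous f →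
        ∫ ψ, (f ψ).re ∂haarSphere d = (∫ ψ, f ψ ∂haarSphere d).re := fun f hf =>
      Complex.reCLM.integral_comp_comm (integrable_haarSphere hd hf)
    simp only [averageOverlap, successProbability, outputState, krausMap_apply,
      Finset.univ_unique, Finset.sum_singleton, trace_kraus_tensorPower,
      trace_kraus_tensorPower_mul_pureState]
    have h1 := hre (fun ψ => twoCopyForm (depolarizing d δ (pureState ψ.1))
      fun a b => ∑ i, conj (ψ.1 i) * K i ![a, b])
      (continuous_twoCopyForm δ fun a b => by fun_prop)
    have h2 := hre (fun ψ => ∑ i, twoCopyForm (depolarizing d δ (pureState ψ.1))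
      fun a b => K i ![a, b])
      (continuous_finsetSum _ fun i _ => continuous_twoCopyForm δ fun a b => continuous_const)
    rw [h1, h2,
      integral_trace_kraus hd δ fun i a b => K i ![a, b],
      integral_overlap_kraus hd δ fun i a b => K i ![a, b], Complex.ofReal_re, Complex.ofReal_re]
    exact overlap_le_of_swap_bounds hd hδ (swapNorm_nonneg _ _)
      (contractionNorm_le hd (Or.inl rfl) _) (contractionNorm_le hd (Or.inr rfl) _)
  rw [← averageFunctional_pureState hd, ← averageFunctional_one hd, hsum, map_sum, map_sum,
    Finset.mul_sum]
  refine Finset.sum_le_sum fun l _ => ?_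
  rw [averageFunctional_pureState, averageFunctional_one]
  exact hone (K l)

/-! ### The optimal protocol: symmetric projection. -/

/-- The Kraus operators of the protocol that projects two copies onto the symmetric (`η = 1`) or
antisymmetric (`η = -1`) subspace and discards the second copy. -/
def swapKraus (d : ℕ) (η : ℝ) (c : Fin d) : Matrix (Fin d) (Fin 2 → Fin d) ℂ :=
  Matrix.of fun i a => ((if i = a 0 then 1 else 0) * (if c = a 1 then 1 else 0) +
    η * ((if i = a 1 then 1 else 0) * (if c = a 0 then 1 else 0))) / 2

theorem swapKraus_apply_pair {d : ℕ} (η : ℝ) (c i x y : Fin d) :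
    swapKraus d η c i ![x, y] = ((if i = x then 1 else 0) * (if c = y then 1 else 0) +
      η * ((if i = y then 1 else 0) * (if c = x then 1 else 0))) / 2 := rfl

theorem krausMap_swapKraus_apply {d : ℕ} (η : ℝ)
    (X : Matrix (Fin 2 → Fin d) (Fin 2 → Fin d) ℂ) (i j : Fin d) :
    krausMap (swapKraus d η) X i j =
      (∑ c, (X ![i, c] ![j, c] + η * X ![i, c] ![c, j] + η * X ![c, i] ![j, c] +
        η ^ 2 * X ![c, i] ![c, j])) / 4 := by
  rw [krausMap_apply, Matrix.sum_apply, Finset.sum_div]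
  refine Finset.sum_congr rfl fun c _ => ?_
  have hconj : ∀ a, conj (swapKraus d η c j a) = swapKraus d η c j a := by
    intro a
    simp only [swapKraus, Matrix.of_apply]
    split_ifs <;> simp [map_ofNat]
  simp only [mul_mul_conjTranspose_apply, hconj, sum_fin_two_fun, swapKraus_apply_pair]
  simp [add_mul, mul_add, div_eq_mul_inv, Finset.sum_add_distrib]
  ring

/-- The two projections sum to the identity. Hence the symmetric branch loses exactly the trace of
the antisymmetric one, and the two branches together preserve trace. -/
theorem trace_krausMap_swapKraus_add {d : ℕ} (X : Matrix (Fin 2 → Fin d) (Fin 2 → Fin d) ℂ) :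
    (krausMap (swapKraus d 1) X).trace + (krausMap (swapKraus d (-1)) X).trace = X.trace := by
  have h : ∑ i, ∑ c, X ![c, i] ![c, i] = ∑ i, ∑ c, X ![i, c] ![i, c] := Finset.sum_comm
  simp only [Matrix.trace, Matrix.diag_apply, krausMap_swapKraus_apply, sum_fin_two_fun]
  rw [← Finset.sum_add_distrib]
  simp only [← Finset.sum_div, Finset.sum_add_distrib]
  simp
  rw [h]
  ring

theorem isCPTN_swapKraus (d : ℕ) : IsCPTN (krausMap (swapKraus d 1)) := by
  refine ⟨isCompletelyPositive_krausMap _, fun ρ hρ => ?_⟩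
  rw [← trace_krausMap_swapKraus_add ρ, Complex.add_re]
  have h : (krausMap (swapKraus d (-1)) ρ).PosSemidef := by
    rw [krausMap_apply]
    exact Matrix.posSemidef_sum _ fun l _ => hρ.mul_mul_conjTranspose_same _
  linarith [(Complex.nonneg_iff.mp h.trace_nonneg).1]

theorem isCPTN_swapKraus_add (d : ℕ) :
    IsCPTN (krausMap (swapKraus d 1) + krausMap (swapKraus d (-1))) := by
  have h : krausMap (swapKraus d 1) + krausMap (swapKraus d (-1)) =
      krausMap (Sum.elim (swapKraus d 1) (swapKraus d (-1))) := by
    refine LinearMap.ext fun X => ?_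
    simp [krausMap_apply]
  refine ⟨h ▸ isCompletelyPositive_krausMap _, fun ρ _ => ?_⟩
  rw [LinearMap.add_apply, Matrix.trace_add, trace_krausMap_swapKraus_add]

theorem tensorPower_trace {d n : ℕ} (ρ : Matrix (Fin d) (Fin d) ℂ) :
    (tensorPower n ρ).trace = ρ.trace ^ n := by
  have h := Finset.prod_univ_sum (fun _ => Finset.univ) fun (_ : Fin n) (i : Fin d) => ρ i i
  rw [Fintype.piFinset_univ, Finset.prod_const, Finset.card_univ, Fintype.card_fin] at h
  exact h.symm

theorem pureState_mul_self {d : ℕ} (ψ : Metric.sphere (0 : EuclideanSpace ℂ (Fin d)) 1) :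
    pureState ψ.1 * pureState ψ.1 = pureState ψ.1 := by
  ext i j
  have h := sum_mul_conj_eq_one ψ
  simp only [Matrix.mul_apply, pureState, Matrix.of_apply]
  calc _ = ψ.1 i * star (ψ.1 j) * ∑ k, ψ.1 k * conj (ψ.1 k) := by
        rw [Finset.mul_sum]
        refine Finset.sum_congr rfl fun k _ => ?_
        rw [← Complex.star_def]
        ring
    _ = _ := by rw [h, mul_one]

theorem pureState_trace {d : ℕ} (ψ : Metric.sphere (0 : EuclideanSpace ℂ (Fin d)) 1) :
    (pureState ψ.1).trace = 1 := by
  rw [← sum_mul_conj_eq_one ψ]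
  rfl

theorem depolarizing_pureState {d : ℕ} (δ : ℝ)
    (ψ : Metric.sphere (0 : EuclideanSpace ℂ (Fin d)) 1) :
    depolarizing d δ (pureState ψ.1) =
      ((1 - δ : ℝ) : ℂ) • pureState ψ.1 + ((δ / d : ℝ) : ℂ) • 1 := by
  simp [depolarizing, pureState_trace]

/-- In the partial trace of the symmetrized state, the two terms without a net swap give `ρ tr ρ`
and the two with one give `ρ²`. -/
theorem krausMap_swapKraus_tensorPower {d : ℕ} (ρ : Matrix (Fin d) (Fin d) ℂ)
    (hρ : ρ.trace = 1) :
    krausMap (swapKraus d 1) (tensorPower 2 ρ) = (1 / 2 : ℂ) • (ρ + ρ * ρ) := by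
  ext i j
  rw [krausMap_swapKraus_apply]
  have h : ∑ c, ρ c c = 1 := hρ
  simp only [tensorPower, Matrix.of_apply, Fin.prod_univ_two, Matrix.cons_val_zero,
    Matrix.cons_val_one, Matrix.smul_apply, Matrix.add_apply, Matrix.mul_apply,
    Finset.sum_add_distrib, ← Finset.mul_sum, ← Finset.sum_mul, h, smul_eq_mul]
  rw [show ∑ c, ρ c j * ρ i c = ∑ c, ρ i c * ρ c j from
    Finset.sum_congr rfl fun c _ => mul_comm _ _]
  push_cast
  ring

theorem outputState_swapKraus {d : ℕ} (hd : 1 ≤ d) (δ : ℝ)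
    (ψ : Metric.sphere (0 : EuclideanSpace ℂ (Fin d)) 1) :
    outputState (depolarizing d δ) (krausMap (swapKraus d 1)) ψ.1 =
      (((lam0 d δ + lam0 d δ ^ 2 - (δ / d + (δ / d) ^ 2)) / 2 : ℝ) : ℂ) • pureState ψ.1 +
        (((δ / d + (δ / d) ^ 2) / 2 : ℝ) : ℂ) • 1 := by
  have hd0 : (d : ℂ) ≠ 0 := by exact_mod_cast (by omega : d ≠ 0)
  have htr : (depolarizing d δ (pureState ψ.1)).trace = 1 := by
    rw [depolarizing_pureState]
    simp [pureState_trace]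
    field_simp
    ring
  rw [outputState, krausMap_swapKraus_tensorPower _ htr, depolarizing_pureState, lam0_eq hd]
  simp only [Matrix.mul_add, Matrix.add_mul, Matrix.smul_mul, Matrix.mul_smul, Matrix.mul_one,
    Matrix.one_mul, pureState_mul_self]
  push_cast
  module

theorem averageOverlap_swapKraus {d : ℕ} (hd : 1 ≤ d) (δ : ℝ) :
    averageOverlap (depolarizing d δ) (krausMap (swapKraus d 1)) =
      (lam0 d δ + lam0 d δ ^ 2) / 2 := by
  have := isProbabilityMeasure_haarSphere hd
  simp only [averageOverlap, outputState_swapKraus hd, Matrix.add_mul, Matrix.smul_mul,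
    Matrix.one_mul, pureState_mul_self, Matrix.trace_add, Matrix.trace_smul, pureState_trace,
    smul_eq_mul, mul_one, ← Complex.ofReal_add, Complex.ofReal_re]
  simp
  ring

theorem successProbability_swapKraus {d : ℕ} (hd : 1 ≤ d) (δ : ℝ) :
    successProbability (depolarizing d δ) (krausMap (swapKraus d 1)) = p2 d δ := by
  have := isProbabilityMeasure_haarSphere hd
  have hd0 : (d : ℝ) ≠ 0 := by exact_mod_cast (by omega : d ≠ 0)
  simp only [successProbability, outputState_swapKraus hd, Matrix.trace_add, Matrix.trace_smul,
    pureState_trace, Matrix.trace_one, Fintype.card_fin, smul_eq_mul, mul_one,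
    ← Complex.ofReal_natCast, ← Complex.ofReal_mul, ← Complex.ofReal_add, Complex.ofReal_re]
  rw [p2_eq hd, lam0_eq hd]
  simp
  field_simp
  ring

theorem successProbability_swapKraus_add {d : ℕ} (hd : 1 ≤ d) (δ : ℝ) :
    successProbability (depolarizing d δ)
      (krausMap (swapKraus d 1) + krausMap (swapKraus d (-1))) = 1 := by
  have := isProbabilityMeasure_haarSphere hd
  have hd0 : (d : ℂ) ≠ 0 := by exact_mod_cast (by omega : d ≠ 0)
  have htr : ∀ ψ : Metric.sphere (0 : EuclideanSpace ℂ (Fin d)) 1,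
      (depolarizing d δ (pureState ψ.1)).trace = 1 := by
    intro ψ
    rw [depolarizing_pureState]
    simp [pureState_trace]
    field_simp
    ring
  simp only [successProbability, outputState, LinearMap.add_apply, Matrix.trace_add,
    trace_krausMap_swapKraus_add, tensorPower_trace, htr]
  simp

/-! ### Attainment, optimal value and monotonicity. -/

theorem fidelitySet_nonempty {d : ℕ} (hd : 1 ≤ d) (δ : ℝ) {p : ℝ} (hp : p ∈ Ioo (0 : ℝ) 1) :
    (fidelitySet (depolarizing d δ) 2 p).Nonempty := by
  refine ⟨_, _, (isCPTN_swapKraus_add d).smul hp.1.le hp.2.le, ?_, rfl⟩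
  rw [successProbability_smul hd, successProbability_swapKraus_add hd, mul_one]

theorem isGreatest_maxFidelity {d : ℕ} (hd : 1 ≤ d) (δ : ℝ) {p : ℝ} (hp : p ∈ Ioo (0 : ℝ) 1) :
    IsGreatest (fidelitySet (depolarizing d δ) 2 p) (maxFidelity (depolarizing d δ) 2 p) :=
  (isCompact_fidelitySet hd 2 δ p).isGreatest_sSup (fidelitySet_nonempty hd δ hp)

theorem maxFidelity_le_f2 {d : ℕ} (hd : 1 ≤ d) {δ : ℝ} (hδ : δ ∈ Icc (0 : ℝ) 1) {p : ℝ}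
    (hp : p ∈ Ioo (0 : ℝ) 1) : maxFidelity (depolarizing d δ) 2 p ≤ f2 d δ := by
  obtain ⟨E, hE, hs, hf⟩ := (isGreatest_maxFidelity hd δ hp).1
  rw [hf, hs, div_le_iff₀ hp.1, ← hs]
  exact averageOverlap_le hd hδ hE.1

theorem maxFidelity_eq_f2 {d : ℕ} (hd : 1 ≤ d) {δ : ℝ} (hδ : δ ∈ Icc (0 : ℝ) 1) {p : ℝ}
    (hp : p ∈ Ioo (0 : ℝ) 1) (hle : p ≤ p2 d δ) :
    maxFidelity (depolarizing d δ) 2 p = f2 d δ := by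
  have hp2 := p2_pos hd δ
  refine le_antisymm (maxFidelity_le_f2 hd hδ hp) ((isGreatest_maxFidelity hd δ hp).2 ?_)
  have hs : successProbability (depolarizing d δ)
      ((p / p2 d δ) • krausMap (swapKraus d 1)) = p := by
    rw [successProbability_smul hd, successProbability_swapKraus hd]
    field_simp
  refine ⟨_, (isCPTN_swapKraus d).smul (div_nonneg hp.1.le hp2.le) ((div_le_one hp2).mpr hle),
    hs, ?_⟩
  have := hp.1.ne'
  rw [hs, averageOverlap_smul hd, averageOverlap_swapKraus hd, f2]
  field_simp

/-- An optimal protocol for `q`, scaled by `p / q ≤ 1`, is admissible for `p` with the same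
fidelity. -/
theorem antitoneOn_maxFidelity {d : ℕ} (hd : 1 ≤ d) (δ : ℝ) :
    AntitoneOn (fun p => maxFidelity (depolarizing d δ) 2 p) (Ioo (0 : ℝ) 1) := by
  intro p hp q hq hpq
  obtain ⟨E, hE, hs, hf⟩ := (isGreatest_maxFidelity hd δ hq).1
  refine (isGreatest_maxFidelity hd δ hp).2 ?_
  have hq0 := hq.1.ne'
  have hp0 := hp.1.ne'
  have hs' : successProbability (depolarizing d δ) ((p / q) • E) = p := by
    rw [successProbability_smul hd, hs]
    field_simp
  refine ⟨_, hE.smul (div_nonneg hp.1.le hq.1.le) ((div_le_one hq.1).mpr hpq), hs', ?_⟩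
  simp only [hf, hs, hs', averageOverlap_smul hd]
  field_simp

theorem isGreatest_image_maxFidelity {d : ℕ} (hd : 1 ≤ d) {δ : ℝ} (hδ : δ ∈ Icc (0 : ℝ) 1) :
    IsGreatest ((fun p => maxFidelity (depolarizing d δ) 2 p) '' Ioo (0 : ℝ) 1) (f2 d δ) := by
  constructor
  · have hp2 := p2_pos hd δ
    -- `p2` itself can equal `1`, for instance at `δ = 0`, and then lies outside the open interval.
    have hmem : min (p2 d δ) (1 / 2) ∈ Ioo (0 : ℝ) 1 :=
      ⟨lt_min hp2 (by norm_num), (min_le_right _ _).trans_lt (by norm_num)⟩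
    exact ⟨_, hmem, maxFidelity_eq_f2 hd hδ hmem (min_le_left _ _)⟩
  · rintro _ ⟨p, hp, rfl⟩
    exact maxFidelity_le_f2 hd hδ hp

end Purification

end

theorem proposition2 (d : ℕ) (hd : 1 ≤ d) (δ : ℝ) (hδ : δ ∈ Set.Icc (0 : ℝ) 1) :
    -- the maximum that defines the fidelity exists for each probability
    (∀ p ∈ Set.Ioo (0 : ℝ) 1,
      IsGreatest (Purification.fidelitySet (Purification.depolarizing d δ) 2 p)
        (Purification.maxFidelity (Purification.depolarizing d δ) 2 p)) ∧
    (∀ p ∈ Set.Ioo (0 : ℝ) 1,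
      Purification.maxFidelity (Purification.depolarizing d δ) 2 p ≤ Purification.f2 d δ) ∧
    (∀ p ∈ Set.Ioo (0 : ℝ) 1, p ≤ Purification.p2 d δ →
      Purification.maxFidelity (Purification.depolarizing d δ) 2 p = Purification.f2 d δ) ∧
    IsGreatest
      ((fun p => Purification.maxFidelity (Purification.depolarizing d δ) 2 p) ''
        Set.Ioo (0 : ℝ) 1)
      (Purification.f2 d δ) ∧
    AntitoneOn (fun p => Purification.maxFidelity (Purification.depolarizing d δ) 2 p)
      (Set.Ioo (0 : ℝ) 1) := by
  exact ⟨fun p hp => Purification.isGreatest_maxFidelity hd δ hp,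
    fun p hp => Purification.maxFidelity_le_f2 hd hδ hp,
    fun p hp hle => Purification.maxFidelity_eq_f2 hd hδ hp hle,
    Purification.isGreatest_image_maxFidelity hd hδ,
    Purification.antitoneOn_maxFidelity hd δ⟩
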